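/- **Setting.** Let $k, M_1,M_2,M_3$ be positive integers, $\varepsilon=1/k$, $x_\ell=\varepsilon\ell$ for $\ell\in\mathbb Z^3$, $\Omega=\prod_{i=1}^3[-M_i+1,M_i]$ and $\mathfrak L=\mathbb Z^3\cap\varepsilon^{-1}\Omega$. Let $\mathscr V$ be the set of all $v:\mathbb Z^3\to\mathbb R^3$ that are periodic with basic period $\Omega$, i.e. $v_{\ell+k(2M_i-1)e_i}=v_\ell$ for $i=1,2,3$, and satisfy $\sum_{\ell\in\mathfrak L}v_\ell=0$. Let $R\subset\mathbb Z^3$ be finite with $\eta_1\eta_2\eta_3\neq0$ for all $\eta\in R$, let $\mathsf F\in\mathbb R^{3\times3}$ with $\det\mathsf F>0$, and for $\eta\in R$ let $\phi_\eta:\mathbb R^3\to\mathbb R$ be differentiable at $\mathsf F\eta$. Write $\overline D_\eta y_\ell=(y_{\ell+\eta}-y_\ell)/\varepsilon$. For $\ell,\eta\in\mathbb Z^3$ with $\eta_1\eta_2\eta_3\ne0$, the *bond volume* $B_{\ell,\eta}$ is the open box with edges parallel to the axes and main diagonal from $x_\ell$ to $x_{\ell+\eta}$. Its *type A decomposition*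 consists of the six tetrahedra that join $x_\ell$ to $x_{\ell+\eta}$ along three edges of the box, in the six possible orders of the directions. A *cell tetrahedron* is a tetrahedron of the type A decomposition of some lattice cell $B_{\ell,(1,1,1)}$. All tetrahedra are closed. **Splitting.** The cell tetrahedra contained in $\Omega$ are divided into two disjoint families; $\Omega_a$ and $\Omega_*$ are the interiors of the closures of the unions of the first and of the second family. Both are assumed connected (and nonempty). Put $\Gamma=\overline\Omega_a\cap\overline\Omega_*$. Assume that $\overline\Omega_a$ lies in the interior of $\Omega$, and so does $\overline B_{\ell,\eta}$ whenever $\eta\in R$ and $\overline B_{\ell,\eta}\cap\overline\Omega_a\neq\emptyset$. Let $B_\Gamma$ be the set of *interface bond volumes*: $B_{\ell,\eta}\in B_\Gamma$ if $B_{\ell,\eta}\cap\Gamma\ne\emptyset$, or if $B_{\ell,\eta}\subset\Omega_a$ and $\overline B_{\ell,\eta}\cap\Gamma\neq\emptyset$. **Interface decompositions.** For each $\eta\in R$ and each $B_{\ell,\eta}\in B_\Gamma$ let $\mathcal T(B_{\ell,\eta})$ be a finite set of nondegenerate tetrahedra with vertices in $\varepsilon\mathbb Z^3$ and union $\overline B_{\ell,\eta}$,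 such that 1. each $T\in\mathcal T(B_{\ell,\eta})$ either is contained in $\overline\Omega_a$, or is a cell tetrahedron contained in $\overline\Omega_*$; 2. the decomposition is conforming, and compatible with those of the bond volumes that share a face with $B_{\ell,\eta}$: if $\ell'=\ell$ or $\ell'=\ell\pm\eta_ie_i$ for some $i$, then any $T\in\mathcal T(B_{\ell,\eta})$ and $T'\in\mathcal T(B_{\ell',\eta})$ intersect exactly in the convex hull of their common vertices. Here, for $B_{\ell',\eta}\notin B_\Gamma$, $\mathcal T(B_{\ell',\eta})$ denotes the type A decomposition of $B_{\ell',\eta}$ if $\overline B_{\ell',\eta}\subset\Omega_a$, and the set of cell tetrahedra contained in $\overline B_{\ell',\eta}$ otherwise. **Energy.** For a lattice function $y:\mathbb Z^3\to\mathbb R^3$ let $\overline y$ be the continuous function on $\mathbb R^3$ that is affine on every cell tetrahedron and satisfies $\overline y(x_\ell)=y_\ell$ for all $\ell$. For $B_{\ell,\eta}\in B_\Gamma$ let $y^{\ell,\eta}$ be the continuous function on $\overline B_{\ell,\eta}$ that is affine on each $T\in\mathcal T(B_{\ell,\eta})$ and interpolates $\{y_\ell\}$ at the vertices of $T$. Define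 $$\mathcal E_{bv}\{y\}=\sum_{\eta\in R}\Big(\varepsilon^3\!\!\sum_{\substack{\ell\in\mathfrak L\\ \overline B_{\ell,\eta}\subset\Omega_a}}\!\!\phi_\eta(\overline D_\eta y_\ell)+\int_{\Omega_*}\!\phi_\eta(\nabla\overline y(x)\,\eta)\,dx+\!\!\sum_{\substack{\ell\in\mathfrak L\\ B_{\ell,\eta}\in B_\Gamma}}\!\frac1{|\eta_1\eta_2\eta_3|}\int_{B_{\ell,\eta}}\!\chi_{\Omega_a}\,\phi_\eta(\nabla y^{\ell,\eta}(x)\,\eta)\,dx\Big).$$ **Proposition 4.1.** The energy $\mathcal E_{bv}$ is free of ghost forces: for the homogeneous deformation $(y_{\mathsf F})_\ell=\mathsf Fx_\ell$ and every $v\in\mathscr V$, the function $t\mapsto\mathcal E_{bv}\{y_{\mathsf F}+tv\}$ is differentiable at $t=0$ and $$\langle D\mathcal E_{bv}(y_{\mathsf F}),v\rangle=\frac{d}{dt}\Big|_{t=0}\mathcal E_{bv}\{y_{\mathsf F}+tv\}=0 .$$ -/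

import Mathlib

noncomputable section

namespace BondVolume

open MeasureTheory

/-- Indices `ℓ` of lattice points, also interaction vectors `η`. -/
abbrev Lat := Fin 3 → ℤ

/-- Space `ℝ³` (only its vector space structure, topology and Lebesgue measure are used). -/
abbrev R3 := Fin 3 → ℝ

/-- The point `x_ℓ = ε ℓ` of the scaled lattice, where the lattice distance is `ε = 1 / k`. -/
def pos (k : ℕ) (ℓ : Lat) : R3 := fun i => (ℓ i : ℝ) / k

/-- The periodic domain `Ω = ∏ᵢ [-Mᵢ + 1, Mᵢ]`. -/
def domain (M : Fin 3 → ℕ) : Set R3 := Set.Icc (fun i => -(M i : ℝ) + 1) (fun i => (M i : ℝ))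

/-- `𝔏 = ℤ³ ∩ ε⁻¹ Ω`. -/
def latticePeriod (k : ℕ) (M : Fin 3 → ℕ) : Finset Lat :=
  Finset.Icc (fun i => (k : ℤ) * (-(M i : ℤ) + 1)) (fun i => (k : ℤ) * (M i : ℤ))

/-- The lattice displacements: lattice functions (extended to all of `ℤ³`) that are periodic with
basic period `Ω`, whose `i`-th side has length `2 Mᵢ - 1`, i.e. `k (2 Mᵢ - 1)` lattice spacings,
and that have zero average over `𝔏`. -/
def displacements (k : ℕ) (M : Fin 3 → ℕ) : Set (Lat → R3) :=
  {v | (∀ (ℓ : Lat) (i : Fin 3), v (ℓ + Pi.single i ((k : ℤ) * (2 * (M i : ℤ) - 1))) = v ℓ) ∧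
    ∑ ℓ ∈ latticePeriod k M, v ℓ = 0}

/-- The homogeneous deformation `y_F(x) = F x` at the lattice points. -/
def homogeneous (k : ℕ) (F : Matrix (Fin 3) (Fin 3) ℝ) : Lat → R3 := fun ℓ => F.mulVec (pos k ℓ)

/-- The difference quotient `(y_{ℓ+η} - y_ℓ) / ε`. -/
def diffQuot (k : ℕ) (η : Lat) (y : Lat → R3) (ℓ : Lat) : R3 := (k : ℝ) • (y (ℓ + η) - y ℓ)

/-! A tetrahedron with lattice vertices is represented by the set of indices of its vertices. -/

/-- The closed tetrahedron with the given vertices. -/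
def tet (k : ℕ) (T : Finset Lat) : Set R3 := convexHull ℝ (pos k '' (T : Set Lat))

/-- The type A decomposition of the box with main diagonal from `x_ℓ` to `x_{ℓ+η}` into six
tetrahedra. Each of them joins `x_ℓ` to `x_{ℓ+η}` along three edges of the box, taken in one of the
six orders; its edges are edges of the box, the main diagonal, a face diagonal starting at
`x_ℓ` and a face diagonal ending at `x_{ℓ+η}`. -/
def typeA (ℓ η : Lat) : Finset (Finset Lat) :=
  Finset.univ.image fun σ : Equiv.Perm (Fin 3) =>
    Finset.univ.image fun j : Fin 4 => fun i => ℓ i + if (σ i).val < j.val then η i else 0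

/-- The tetrahedra of the type A decompositions of all lattice cells `K_ℓ`. -/
def cellTets : Set (Finset Lat) := {T | ∃ ℓ : Lat, T ∈ typeA ℓ 1}

/-- The mesh `𝒯_T` of the domain `Ω`. -/
def domainTets (k : ℕ) (M : Fin 3 → ℕ) : Set (Finset Lat) :=
  {T | T ∈ cellTets ∧ tet k T ⊆ domain M}

/-- `w` are barycentric coordinates of `x` in the tetrahedron `T`. -/
def IsBarycentric (k : ℕ) (T : Finset Lat) (w : Lat → ℝ) (x : R3) : Prop :=
  (∀ ℓ ∈ T, 0 ≤ w ℓ) ∧ ∑ ℓ ∈ T, w ℓ = 1 ∧ ∑ ℓ ∈ T, w ℓ • pos k ℓ = x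

open Classical in
/-- The piecewise linear interpolant of the lattice function `y` on a family of
tetrahedra: on every tetrahedron it is the affine function with the values `y_ℓ` at the vertices
`x_ℓ` (outside all of them it is `0`, which is never used). It is well defined, and continuous on
the union of a finite family, when the tetrahedra are nondegenerate and conforming. -/
def interp (k : ℕ) (𝒯 : Set (Finset Lat)) (y : Lat → R3) (x : R3) : R3 :=
  if h : ∃ p : Finset Lat × (Lat → ℝ), p.1 ∈ 𝒯 ∧ IsBarycentric k p.1 p.2 x then
    ∑ ℓ ∈ h.choose.1, h.choose.2 ℓ • y ℓ
  else 0

/-- The bond volume: the open box with edges parallel to the axes and main diagonal from `x_ℓ` to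
`x_{ℓ+η}`. -/
def bondVolume (k : ℕ) (ℓ η : Lat) : Set R3 :=
  Set.univ.pi fun i => Set.Ioo (min (pos k ℓ i) (pos k (ℓ + η) i)) (max (pos k ℓ i) (pos k (ℓ + η) i))

/-- The interior of the closure of the union of a set of tetrahedra. -/
def region (k : ℕ) (S : Set (Finset Lat)) : Set R3 := interior (closure (⋃ T ∈ S, tet k T))

/-- The A-CB region `Ω_*`: it consists of the tetrahedra of `Ω` that are not in the atomistic
region. The atomistic region itself is `Ω_a = region k Sa`. -/
def acbRegion (k : ℕ) (M : Fin 3 → ℕ) (Sa : Set (Finset Lat)) : Set R3 :=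
  region k (domainTets k M \ Sa)

/-- The interface `Γ`. -/
def interface (k : ℕ) (M : Fin 3 → ℕ) (Sa : Set (Finset Lat)) : Set R3 :=
  closure (region k Sa) ∩ closure (acbRegion k M Sa)

/-- `Sa` is a set of tetrahedra that defines an atomistic/A-CB splitting of `Ω`:
both regions are connected, and the atomistic region is so far from the boundary
of `Ω` that every bond volume that touches it stays inside `Ω`. -/
structure IsSplitting (k : ℕ) (M : Fin 3 → ℕ) (R : Finset Lat) (Sa : Set (Finset Lat)) : Prop where
  subset : Sa ⊆ domainTets k M
  connected_atomistic : IsConnected (region k Sa)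
  connected_acb : IsConnected (acbRegion k M Sa)
  closure_subset : closure (region k Sa) ⊆ interior (domain M)
  far : ∀ η ∈ R, ∀ ℓ : Lat, (closure (bondVolume k ℓ η) ∩ closure (region k Sa)).Nonempty →
    closure (bondVolume k ℓ η) ⊆ interior (domain M)

/-- The bond volume belongs to the atomistic region. -/
def IsAtomistic (k : ℕ) (Sa : Set (Finset Lat)) (η ℓ : Lat) : Prop :=
  closure (bondVolume k ℓ η) ⊆ region k Sa

/-- The bond volume is an interface bond volume, i.e. it belongs to `B_Γ`. -/
def IsInterfacial (k : ℕ) (M : Fin 3 → ℕ) (Sa : Set (Finset Lat)) (η ℓ : Lat) : Prop :=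
  (bondVolume k ℓ η ∩ interface k M Sa).Nonempty ∨
    (bondVolume k ℓ η ⊆ region k Sa ∧ (closure (bondVolume k ℓ η) ∩ interface k M Sa).Nonempty)

open Classical in
/-- The tetrahedra that decompose an arbitrary bond volume: the type A decomposition if
it belongs to the atomistic region, the chosen decomposition `𝒟 ℓ` if it is an interface bond
volume, and the tetrahedra of the lattice cells in it otherwise. -/
def bondTets (k : ℕ) (M : Fin 3 → ℕ) (Sa : Set (Finset Lat)) (η : Lat)
    (𝒟 : Lat → Finset (Finset Lat)) (ℓ : Lat) : Set (Finset Lat) :=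
  if IsAtomistic k Sa η ℓ then (typeA ℓ η : Set (Finset Lat))
  else if IsInterfacial k M Sa η ℓ then (𝒟 ℓ : Set (Finset Lat))
  else {T | T ∈ cellTets ∧ tet k T ⊆ closure (bondVolume k ℓ η)}

/-- `B_{ℓ',η}` is `B_{ℓ,η}` itself or one of the six bond volumes that share a face with it. -/
def IsEqOrAdjacent (η ℓ ℓ' : Lat) : Prop :=
  ℓ' = ℓ ∨ ∃ i : Fin 3, ℓ' = ℓ + Pi.single i (η i) ∨ ℓ' = ℓ - Pi.single i (η i)

/-- `𝒟 ℓ` is an admissible decomposition of every interface bond volume `B_{ℓ,η}`. -/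
structure IsAdmissible (k : ℕ) (M : Fin 3 → ℕ) (Sa : Set (Finset Lat)) (η : Lat)
    (𝒟 : Lat → Finset (Finset Lat)) : Prop where
  /-- it consists of nondegenerate tetrahedra with lattice vertices, -/
  nondegenerate : ∀ ℓ, IsInterfacial k M Sa η ℓ → ∀ T ∈ 𝒟 ℓ,
    T.card = 4 ∧ AffineIndependent ℝ (fun p : T => pos k (p : Lat))
  /-- that fill the closed bond volume; -/
  cover : ∀ ℓ, IsInterfacial k M Sa η ℓ → ⋃ T ∈ 𝒟 ℓ, tet k T = closure (bondVolume k ℓ η)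
  /-- no tetrahedron crosses the interface, and those on the A-CB side come from the
  type A decomposition of a lattice cell; -/
  subordinate : ∀ ℓ, IsInterfacial k M Sa η ℓ → ∀ T ∈ 𝒟 ℓ,
    tet k T ⊆ closure (region k Sa) ∨ (T ∈ cellTets ∧ tet k T ⊆ closure (acbRegion k M Sa))
  /-- the decomposition is conforming, and compatible with those of the bond volumes that share a
  face: any two tetrahedra meet in the convex hull of their common vertices. -/
  conforming : ∀ ℓ, IsInterfacial k M Sa η ℓ → ∀ ℓ', IsEqOrAdjacent η ℓ ℓ' →
    ∀ T ∈ 𝒟 ℓ, ∀ T' ∈ bondTets k M Sa η 𝒟 ℓ', tet k T ∩ tet k T' = tet k (T ∩ T')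

open Classical in
/-- The contribution of the bond volumes in the atomistic region. -/
def energyAtomistic (k : ℕ) (M : Fin 3 → ℕ) (Sa : Set (Finset Lat)) (φ : Lat → R3 → ℝ) (η : Lat)
    (y : Lat → R3) : ℝ :=
  (1 / (k : ℝ)) ^ 3 * ∑ ℓ ∈ latticePeriod k M with IsAtomistic k Sa η ℓ, φ η (diffQuot k η y ℓ)

/-- The contribution `∫_{Ω_*} φ_η(∇ȳ(x) η) dx` of the A-CB region. -/
def energyACB (k : ℕ) (M : Fin 3 → ℕ) (Sa : Set (Finset Lat)) (φ : Lat → R3 → ℝ) (η : Lat)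
    (y : Lat → R3) : ℝ :=
  ∫ x in acbRegion k M Sa, φ η (fderiv ℝ (interp k cellTets y) x (fun i => (η i : ℝ)))

open Classical in
/-- The contribution of the parts in `Ω_a` of the interface bond volumes. -/
def energyInterface (k : ℕ) (M : Fin 3 → ℕ) (Sa : Set (Finset Lat)) (φ : Lat → R3 → ℝ) (η : Lat)
    (𝒟 : Lat → Finset (Finset Lat)) (y : Lat → R3) : ℝ :=
  ∑ ℓ ∈ latticePeriod k M with IsInterfacial k M Sa η ℓ,
    1 / |(η 0 * η 1 * η 2 : ℝ)| * ∫ x in bondVolume k ℓ η, (region k Sa).indicator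
      (fun x => φ η (fderiv ℝ (interp k (𝒟 ℓ : Set (Finset Lat)) y) x (fun i => (η i : ℝ)))) x

/-- The bond-volume coupled energy, where `𝒯 η ℓ` is the decomposition chosen for the
interface bond volume `B_{ℓ,η}`. -/
def energyBV (k : ℕ) (M : Fin 3 → ℕ) (R : Finset Lat) (Sa : Set (Finset Lat)) (φ : Lat → R3 → ℝ)
    (𝒯 : Lat → Lat → Finset (Finset Lat)) (y : Lat → R3) : ℝ :=
  ∑ η ∈ R, (energyAtomistic k M Sa φ η y + energyACB k M Sa φ η y +
    energyInterface k M Sa φ η (𝒯 η) y)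

end BondVolume

end

noncomputable section

namespace BondVolume

open MeasureTheory Set Filter Topology

variable {k : ℕ}

/-! Fix `η` and put `N = |η₁η₂η₃|`. At the homogeneous state every strain in the direction `η`
equals `Fη`, so the first variation is one linear functional, the derivative of `φ η` at `Fη`,
applied to a vector that is linear in `v`: the atomistic sum of difference quotients, plus the
integral of `∇v̄ η` over `Ω_*`, plus the weighted interface integrals. This vector is shown to be
zero (`sum_diffQuot_add_setIntegral_add_sum`).

In a type A decomposition the main diagonal is an edge of each tetrahedron, so `∇v η` is the
constant difference quotient there. A bond volume has volume `ε³N`, so each atomistic term is also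
`1/N` times the integral of an interpolated gradient over its bond volume. Atomistic and interface
terms thus have the same form.

The bond volumes with a fixed `η` form `N` partitions of space, one for each residue class of `ℓ`
modulo `η`. On one partition the local interpolants glue to a Lipschitz function `w`
(`isMesh_cosetTets`, `exists_lipschitzWith_interp_cosetTets`) that equals `v̄` outside the closure
of `Ω_a`. Since `w - v̄` has compact support, its gradient has integral zero, and since `v̄` is
periodic, its gradient has integral zero over `Ω`. Hence `∫_{Ω_a} ∇w η = ∫_{Ω_a} ∇v̄ η = -∫_{Ω_*}
∇v̄ η` for every partition (`setIntegral_region_add_setIntegral_acb`). Averaging over the `N`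
partitions cancels the A-CB term.

The gluing rests on the compatibility across faces and, for type A decompositions, on a formula for
the interpolant that does not mention the tetrahedron (`sum_chainSimplex_eq_integral`). -/

lemma pos_injective (hk : 0 < k) : Function.Injective (pos k) := by
  intro p q h
  funext i
  have := congrFun h i
  have hk' : (k : ℝ) ≠ 0 := by positivity
  simp only [pos] at this
  field_simp at this
  exact_mod_cast this

lemma mul_pos_apply (hk : 0 < k) (p : Lat) (i : Fin 3) : (k : ℝ) * pos k p i = p i := by
  have hk' : (k : ℝ) ≠ 0 := by positivity
  simp only [pos]
  field_simp

lemma intCast_eq_smul_pos_sub (hk : 0 < k) (ℓ η : Lat) :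
    (fun i => (η i : ℝ)) = (k : ℝ) • (pos k (ℓ + η) - pos k ℓ) := by
  funext i
  rw [Pi.smul_apply, Pi.sub_apply, smul_eq_mul, mul_sub, mul_pos_apply hk, mul_pos_apply hk]
  simp

/-! ### Tetrahedra, barycentric coordinates and agreement of affine interpolations. -/

lemma mem_tet_iff (hk : 0 < k) {T : Finset Lat} {x : R3} :
    x ∈ tet k T ↔ ∃ w, IsBarycentric k T w x := by
  classical
  constructor
  · intro h
    have h' : x ∈ convexHull ℝ ((T.image (pos k) : Finset R3) : Set R3) := by
      rwa [Finset.coe_image]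
    obtain ⟨w, h0, h1, h2⟩ := Finset.mem_convexHull'.1 h'
    rw [Finset.sum_image (pos_injective hk).injOn] at h1 h2
    exact ⟨fun p => w (pos k p), fun p hp => h0 _ (Finset.mem_image_of_mem _ hp), h1, h2⟩
  · rintro ⟨w, h0, h1, rfl⟩
    exact (convex_convexHull ℝ _).sum_mem h0 h1
      fun p hp => subset_convexHull ℝ _ ⟨p, hp, rfl⟩

lemma pos_mem_tet {T : Finset Lat} {p : Lat} (hp : p ∈ T) : pos k p ∈ tet k T :=
  subset_convexHull ℝ _ ⟨p, hp, rfl⟩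

lemma isClosed_tet (T : Finset Lat) : IsClosed (tet k T) :=
  ((T.finite_toSet.image (pos k)).isCompact_convexHull (𝕜 := ℝ)).isClosed

lemma convex_tet (T : Finset Lat) : Convex ℝ (tet k T) := convex_convexHull ℝ _

/-- The frontier of a convex set is null and there are only countably many finite vertex sets.
Integrals therefore see only interiors, where interpolants are affine. -/
lemma ae_mem_interior_tet (k : ℕ) :
    ∀ᵐ x : R3, ∀ T : Finset Lat, x ∈ tet k T → x ∈ interior (tet k T) := by
  rw [ae_all_iff]
  intro T
  have h := (convex_tet (k := k) T).addHaar_frontier volume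
  filter_upwards [measure_eq_zero_iff_ae_notMem.1 h] with x hx hxT
  by_contra hxi
  exact hx ⟨subset_closure hxT, hxi⟩

/-- Every function on the vertices of `T` extends to an affine map. -/
def Interpolable (k : ℕ) (T : Finset Lat) : Prop :=
  ∀ y : Lat → R3, ∃ A : R3 →ᵃ[ℝ] R3, ∀ p ∈ T, A (pos k p) = y p

/-- The affine interpolations on `T` and on `T'` agree on the intersection. -/
def Agree (k : ℕ) (T T' : Finset Lat) : Prop :=
  ∀ (x : R3) (w w' : Lat → ℝ), IsBarycentric k T w x → IsBarycentric k T' w' x →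
    ∀ y : Lat → R3, ∑ p ∈ T, w p • y p = ∑ p ∈ T', w' p • y p

lemma Agree.symm {T T' : Finset Lat} (h : Agree k T T') : Agree k T' T :=
  fun x w w' hw hw' y => (h x w' w hw' hw y).symm

lemma IsBarycentric.affine_eq {T : Finset Lat} {w : Lat → ℝ} {x : R3}
    (h : IsBarycentric k T w x) (A : R3 →ᵃ[ℝ] R3) : A x = ∑ p ∈ T, w p • A (pos k p) := by
  obtain ⟨-, h1, rfl⟩ := h
  have hA : ∀ z, A z = A.linear z + A 0 := fun z => congrFun A.decomp z
  rw [hA]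
  simp_rw [hA (pos k _), smul_add, Finset.sum_add_distrib, ← Finset.sum_smul, h1, map_sum,
    map_smul, one_smul]

lemma IsBarycentric.sum_smul_congr {T : Finset Lat} {w w' : Lat → ℝ} {x : R3}
    (hT : Interpolable k T) (h : IsBarycentric k T w x) (h' : IsBarycentric k T w' x)
    (y : Lat → R3) : ∑ p ∈ T, w p • y p = ∑ p ∈ T, w' p • y p := by
  obtain ⟨A, hA⟩ := hT y
  have e := h.affine_eq A
  rw [h'.affine_eq A] at e
  have hs : ∀ u : Lat → ℝ, ∑ p ∈ T, u p • A (pos k p) = ∑ p ∈ T, u p • y p :=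
    fun u => Finset.sum_congr rfl fun p hp => by rw [hA p hp]
  rw [← hs, ← hs, e]

/-- A common point has barycentric coordinates supported on the common vertices. Extended by zero
they serve both tetrahedra, and on each of them the interpolated value does not depend on the choice
of coordinates. -/
lemma Agree.of_inter (hk : 0 < k) {T T' : Finset Lat} (hT : Interpolable k T)
    (hT' : Interpolable k T') (h : tet k T ∩ tet k T' = tet k (T ∩ T')) : Agree k T T' := by
  classical
  intro x w w' hw hw' y
  have hx : x ∈ tet k (T ∩ T') := h ▸ ⟨(mem_tet_iff hk).2 ⟨w, hw⟩, (mem_tet_iff hk).2 ⟨w', hw'⟩⟩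
  obtain ⟨u, u0, u1, u2⟩ := (mem_tet_iff hk).1 hx
  let u' : Lat → ℝ := fun p => if p ∈ T ∩ T' then u p else 0
  have key : ∀ S : Finset Lat, T ∩ T' ⊆ S → IsBarycentric k S u' x ∧
      ∑ p ∈ S, u' p • y p = ∑ p ∈ T ∩ T', u p • y p := by
    intro S hS
    refine ⟨⟨fun p _ => ?_, ?_, ?_⟩, ?_⟩
    · by_cases hp : p ∈ T ∩ T'
      · simp only [u', if_pos hp]; exact u0 p hp
      · simp only [u', if_neg hp]; exact le_rfl
    · rw [← u1, ← Finset.sum_subset hS fun p _ hp => by simp only [u', if_neg hp]]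
      exact Finset.sum_congr rfl fun p hp => by simp only [u', if_pos hp]
    · rw [← u2, ← Finset.sum_subset hS fun p _ hp => by simp only [u', if_neg hp, zero_smul]]
      exact Finset.sum_congr rfl fun p hp => by simp only [u', if_pos hp]
    · rw [← Finset.sum_subset hS fun p _ hp => by simp only [u', if_neg hp, zero_smul]]
      exact Finset.sum_congr rfl fun p hp => by simp only [u', if_pos hp]
  obtain ⟨b, e⟩ := key T Finset.inter_subset_left
  obtain ⟨b', e'⟩ := key T' Finset.inter_subset_right
  rw [hw.sum_smul_congr hT b, hw'.sum_smul_congr hT' b', e, e']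

/-- Two different tetrahedra with agreeing interpolations meet in a null set. -/
lemma Agree.volume_inter (hk : 0 < k) {T T' : Finset Lat} (hT : Interpolable k T)
    (hT' : Interpolable k T') (h : Agree k T T') (hne : T ≠ T') :
    volume (tet k T ∩ tet k T') = 0 := by
  classical
  wlog hp : ∃ p ∈ T, p ∉ T' generalizing T T'
  · rw [inter_comm]
    refine this hT' hT h.symm hne.symm ?_
    by_contra! hc
    push Not at hp
    exact hne (Finset.Subset.antisymm hp hc)
  obtain ⟨p, hpT, hpT'⟩ := hp
  -- `A` is, in each component, the barycentric coordinate of the unshared vertex `p`. It vanishes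
  -- on the intersection because `T'` does not use `p`.
  obtain ⟨A, hA⟩ := hT (Pi.single p fun _ => 1)
  have hzero : ∀ x ∈ tet k T ∩ tet k T', A x = 0 := by
    rintro x ⟨hx, hx'⟩
    obtain ⟨w, hw⟩ := (mem_tet_iff hk).1 hx
    obtain ⟨w', hw'⟩ := (mem_tet_iff hk).1 hx'
    rw [hw.affine_eq A, Finset.sum_congr rfl fun q hq => by rw [hA q hq], h x w w' hw hw']
    refine Finset.sum_eq_zero fun q hq => ?_
    rw [Pi.single_eq_of_ne (by rintro rfl; exact hpT' hq), smul_zero]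
  have hcv := ((convex_tet (k := k) T).inter (convex_tet (k := k) T'))
  -- If `A` vanished near `x`, it would vanish along the line from `x` to `p`, but its value at `p`
  -- is one. So the intersection is contained in its own frontier, which is null by convexity.
  have hint : interior (tet k T ∩ tet k T') = ∅ := by
    by_contra hne
    obtain ⟨x, hx⟩ := nonempty_iff_ne_empty.2 hne
    have hev : ∀ᶠ z in 𝓝 x, A z = 0 := by
      filter_upwards [isOpen_interior.mem_nhds hx] with z hz using hzero z (interior_subset hz)
    have hline : ∀ᶠ t : ℝ in 𝓝 0, A (AffineMap.lineMap x (pos k p) t) = 0 := by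
      have : Tendsto (fun t : ℝ => (AffineMap.lineMap x (pos k p) t : R3)) (𝓝 0) (𝓝 x) := by
        have hc : Continuous fun t : ℝ => (AffineMap.lineMap x (pos k p) t : R3) :=
          AffineMap.lineMap_continuous
        simpa using hc.tendsto 0
      exact this.eventually hev
    obtain ⟨t, ht, ht0⟩ :=
      ((hline.filter_mono nhdsWithin_le_nhds).and (self_mem_nhdsWithin (s := {(0 : ℝ)}ᶜ))).exists
    rw [AffineMap.apply_lineMap, hzero x (interior_subset hx), hA p hpT] at ht
    have := congrFun ht 0
    simp [AffineMap.lineMap_apply] at this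
    exact ht0 this
  have hfr := hcv.addHaar_frontier volume
  rwa [((isClosed_tet T).inter (isClosed_tet T')).frontier_eq, hint, sdiff_empty] at hfr

/-! ### Interpolation on a mesh: gradients and Lipschitz bounds. -/

/-- A family of tetrahedra on which interpolation is well defined. -/
structure IsMesh (k : ℕ) (𝒯 : Set (Finset Lat)) : Prop where
  interpolable : ∀ T ∈ 𝒯, Interpolable k T
  agree : ∀ T ∈ 𝒯, ∀ T' ∈ 𝒯, Agree k T T'

variable {𝒯 : Set (Finset Lat)}

lemma IsMesh.interp_eq (h : IsMesh k 𝒯) {T : Finset Lat} (hT : T ∈ 𝒯) {w : Lat → ℝ} {x : R3}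
    (hw : IsBarycentric k T w x) (y : Lat → R3) : interp k 𝒯 y x = ∑ p ∈ T, w p • y p := by
  have hex : ∃ p : Finset Lat × (Lat → ℝ), p.1 ∈ 𝒯 ∧ IsBarycentric k p.1 p.2 x := ⟨(T, w), hT, hw⟩
  rw [interp, dif_pos hex]
  exact h.agree _ hex.choose_spec.1 _ hT x _ _ hex.choose_spec.2 hw y

lemma IsMesh.interp_eqOn_tet (h : IsMesh k 𝒯) (hk : 0 < k) {T : Finset Lat} (hT : T ∈ 𝒯)
    {y : Lat → R3} {A : R3 →ᵃ[ℝ] R3} (hA : ∀ p ∈ T, A (pos k p) = y p) :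
    ∀ x ∈ tet k T, interp k 𝒯 y x = A x := by
  intro x hx
  obtain ⟨w, hw⟩ := (mem_tet_iff hk).1 hx
  rw [h.interp_eq hT hw, hw.affine_eq A]
  exact Finset.sum_congr rfl fun p hp => by rw [hA p hp]

lemma IsMesh.hasFDerivAt (h : IsMesh k 𝒯) (hk : 0 < k) {T : Finset Lat} (hT : T ∈ 𝒯)
    {y : Lat → R3} {A : R3 →ᵃ[ℝ] R3} (hA : ∀ p ∈ T, A (pos k p) = y p) {x : R3}
    (hx : x ∈ interior (tet k T)) :
    HasFDerivAt (interp k 𝒯 y) (LinearMap.toContinuousLinearMap A.linear) x := by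
  have e : (fun z => LinearMap.toContinuousLinearMap A.linear z + A 0) =ᶠ[𝓝 x] interp k 𝒯 y := by
    filter_upwards [isOpen_interior.mem_nhds hx] with z hz
    rw [h.interp_eqOn_tet hk hT hA z (interior_subset hz)]
    exact (congrFun A.decomp z).symm
  exact ((LinearMap.toContinuousLinearMap A.linear).hasFDerivAt.add_const
    (A 0)).congr_of_eventuallyEq e.symm

/-- The chosen tetrahedron and weights depend on `x` only, not on the lattice function, so linearity
needs no mesh property. -/
lemma interp_add_smul (y v : Lat → R3) (t : ℝ) (x : R3) :
    interp k 𝒯 (y + t • v) x = interp k 𝒯 y x + t • interp k 𝒯 v x := by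
  unfold interp
  split_ifs with h
  · simp only [Pi.add_apply, Pi.smul_apply, smul_add, Finset.sum_add_distrib, Finset.smul_sum]
    congr 1
    exact Finset.sum_congr rfl fun p _ => smul_comm _ _ _
  · simp

lemma interp_homogeneous (hk : 0 < k) (F : Matrix (Fin 3) (Fin 3) ℝ) {T : Finset Lat} (hT : T ∈ 𝒯)
    {x : R3} (hx : x ∈ tet k T) : interp k 𝒯 (homogeneous k F) x = F.mulVec x := by
  obtain ⟨w, hw⟩ := (mem_tet_iff hk).1 hx
  have hex : ∃ p : Finset Lat × (Lat → ℝ), p.1 ∈ 𝒯 ∧ IsBarycentric k p.1 p.2 x := ⟨(T, w), hT, hw⟩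
  rw [interp, dif_pos hex]
  have h := hex.choose_spec.2.2.2
  conv_rhs => rw [← h]
  simp [homogeneous, Matrix.mulVec_sum, Matrix.mulVec_smul]

lemma IsMesh.hasFDerivAt_homogeneous_add (h : IsMesh k 𝒯) (hk : 0 < k)
    (F : Matrix (Fin 3) (Fin 3) ℝ) (v : Lat → R3) {T : Finset Lat} (hT : T ∈ 𝒯) {x : R3}
    (hx : x ∈ interior (tet k T)) (t : ℝ) (η : R3) :
    fderiv ℝ (interp k 𝒯 (homogeneous k F + t • v)) x η =
      F.mulVec η + t • fderiv ℝ (interp k 𝒯 v) x η := by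
  obtain ⟨A, hA⟩ := h.interpolable T hT v
  have hv := h.hasFDerivAt hk hT hA hx
  have e : interp k 𝒯 (homogeneous k F + t • v) =ᶠ[𝓝 x]
      fun z => LinearMap.toContinuousLinearMap F.mulVecLin z + t • interp k 𝒯 v z := by
    filter_upwards [isOpen_interior.mem_nhds hx] with z hz
    rw [interp_add_smul, interp_homogeneous hk F hT (interior_subset hz)]
    rfl
  have := ((((LinearMap.toContinuousLinearMap F.mulVecLin).hasFDerivAt (x := x)).add
    (hv.const_smul t)).congr_of_eventuallyEq e).fderiv
  rw [this, hv.fderiv]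
  rfl

/-- With vertex differences bounded by `D`, all vertices of a tetrahedron that meets the unit ball
about `x` lie in one finite box of indices. -/
lemma locallyFinite_tet (hk : 0 < k) {D : ℕ}
    (hD : ∀ T ∈ 𝒯, ∀ p ∈ T, ∀ q ∈ T, ∀ i, |p i - q i| ≤ (D : ℤ)) :
    LocallyFinite fun T : 𝒯 => tet k (T : Finset Lat) := by
  have hk' : (0 : ℝ) < k := by positivity
  intro x
  refine ⟨Metric.ball x 1, Metric.ball_mem_nhds x one_pos, ?_⟩
  let Q : Finset Lat := Finset.Icc (fun i => ⌊(k : ℝ) * x i - k - D⌋)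
    (fun i => ⌈(k : ℝ) * x i + k + D⌉)
  have hfin : ((fun T : 𝒯 => (T : Finset Lat)) ⁻¹' (Q.powerset : Set (Finset Lat))).Finite :=
    Q.powerset.finite_toSet.preimage Subtype.val_injective.injOn
  refine hfin.subset ?_
  rintro ⟨T, hT⟩ ⟨z, hz, hzx⟩
  simp only [mem_preimage, Finset.mem_coe, Finset.mem_powerset]
  intro p hp
  have hsub : tet k T ⊆ Icc (fun i => ((p i : ℝ) - D) / k) (fun i => ((p i : ℝ) + D) / k) := by
    refine convexHull_min ?_ (convex_Icc _ _)
    rintro _ ⟨q, hq, rfl⟩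
    have h := fun i => abs_le.1 (hD T hT p hp q hq i)
    constructor <;> intro i <;> simp only [pos] <;> gcongr
    · have := (h i).2
      have : ((p i : ℝ) - q i) ≤ D := by exact_mod_cast this
      linarith
    · have := (h i).1
      have : (-(D : ℝ)) ≤ ((p i : ℝ) - q i) := by exact_mod_cast this
      linarith
  have hz' := hsub hz
  have hd : ∀ i, |z i - x i| ≤ 1 := fun i =>
    (dist_le_pi_dist z x i).trans (Metric.mem_ball.1 hzx).le
  rw [Finset.mem_Icc]
  constructor <;> intro i
  · have h1 := hz'.2 i
    have h2 := (abs_le.1 (hd i)).1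
    rw [le_div_iff₀ hk'] at h1
    rw [← Int.cast_le (R := ℝ)]
    refine (Int.floor_le _).trans ?_
    nlinarith
  · have h1 := hz'.1 i
    have h2 := (abs_le.1 (hd i)).2
    rw [div_le_iff₀ hk'] at h1
    rw [← Int.cast_le (R := ℝ)]
    refine le_trans ?_ (Int.le_ceil _)
    nlinarith

/-- A function that is `K`-Lipschitz on every member of a locally finite closed cover
of a normed space is `K`-Lipschitz. -/
lemma lipschitzWith_of_locallyFinite {ι E F : Type*} [NormedAddCommGroup E] [NormedSpace ℝ E]
    [PseudoMetricSpace F] {S : ι → Set E} (hS : LocallyFinite S) (hc : ∀ i, IsClosed (S i))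
    (hcov : ∀ x, ∃ i, x ∈ S i) {f : E → F} {K : NNReal} (hf : ∀ i, LipschitzOnWith K f (S i)) :
    LipschitzWith K f := by
  -- Near `x` only members of the cover that contain `x` itself occur, so the Lipschitz bound with
  -- one end fixed at `x` is available.
  have hloc : ∀ x, ∀ᶠ z in 𝓝 x, dist (f z) (f x) ≤ K * dist z x := by
    intro x
    filter_upwards [hS.iInter_compl_mem_nhds hc x] with z hz
    obtain ⟨i, hi⟩ := hcov z
    have hx : x ∈ S i := by
      by_contra hx
      exact (mem_iInter₂.1 hz i hx) hi
    exact (hf i).dist_le_mul z hi x hx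
  have hcont : Continuous f := by
    rw [continuous_iff_continuousAt]
    intro x
    rw [ContinuousAt, tendsto_iff_dist_tendsto_zero]
    refine squeeze_zero' (Eventually.of_forall fun _ => dist_nonneg) (hloc x) ?_
    have : Tendsto (fun z => (K : ℝ) * dist z x) (𝓝 x) (𝓝 (K * dist x x)) :=
      (continuous_const.mul (continuous_id.dist continuous_const)).tendsto x
    simpa using this
  refine LipschitzWith.of_dist_le_mul fun x y => ?_
  let γ : ℝ → E := fun t => AffineMap.lineMap x y t
  have hγ : Continuous γ := AffineMap.lineMap_continuous
  have hγd : ∀ s t, dist (γ s) (γ t) = |s - t| * dist x y := fun s t => by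
    simp only [γ, dist_lineMap_lineMap, Real.dist_eq]
  -- Continuous induction along the segment: the bound measured from `x` is a closed condition on
  -- `t`, and the local estimate at `γ t` pushes it beyond `t`.
  let s : Set ℝ := {t | dist (f (γ t)) (f x) ≤ K * (t * dist x y)}
  have hsc : IsClosed s := isClosed_le ((hcont.comp hγ).dist continuous_const) (by fun_prop)
  have hsub : Icc (0 : ℝ) 1 ⊆ s := by
    refine IsClosed.Icc_subset_of_forall_exists_gt (hsc.inter isClosed_Icc) ?_ ?_
    · simp [s, γ]
    · rintro t ⟨ht, -⟩ t' (ht' : t < t')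
      have h1 : ∀ᶠ r in 𝓝[>] t, dist (f (γ r)) (f (γ t)) ≤ K * dist (γ r) (γ t) :=
        ((hγ.tendsto t).eventually (hloc (γ t))).filter_mono nhdsWithin_le_nhds
      obtain ⟨r, hr, hrt⟩ := (h1.and (Ioc_mem_nhdsGT ht')).exists
      refine ⟨r, ?_, hrt⟩
      have hr' := hrt.1
      rw [hγd, abs_of_pos (sub_pos.2 hr')] at hr
      calc dist (f (γ r)) (f x) ≤ dist (f (γ r)) (f (γ t)) + dist (f (γ t)) (f x) :=
            dist_triangle _ _ _
        _ ≤ K * ((r - t) * dist x y) + K * (t * dist x y) := add_le_add hr ht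
        _ = K * (r * dist x y) := by ring
  have := hsub (right_mem_Icc.2 zero_le_one)
  simp only [s, γ, mem_ofPred_eq, AffineMap.lineMap_apply_one, one_mul] at this
  rwa [dist_comm] at this

/-- Interpolation on a mesh that fills the space, with uniformly bounded gradients. -/
lemma IsMesh.lipschitzWith (h : IsMesh k 𝒯) (hk : 0 < k) {D : ℕ}
    (hD : ∀ T ∈ 𝒯, ∀ p ∈ T, ∀ q ∈ T, ∀ i, |p i - q i| ≤ (D : ℤ))
    (hcov : ∀ x, ∃ T ∈ 𝒯, x ∈ tet k T) {y : Lat → R3} {K : NNReal}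
    (hK : ∀ T ∈ 𝒯, ∃ A : R3 →ᵃ[ℝ] R3, (∀ p ∈ T, A (pos k p) = y p) ∧ LipschitzWith K A) :
    LipschitzWith K (interp k 𝒯 y) := by
  refine lipschitzWith_of_locallyFinite (locallyFinite_tet hk hD) (fun T => isClosed_tet _)
    (fun x => ?_) fun T => ?_
  · obtain ⟨T, hT, hx⟩ := hcov x
    exact ⟨⟨T, hT⟩, hx⟩
  · obtain ⟨A, hA, hAK⟩ := hK T T.2
    intro a ha b hb
    rw [h.interp_eqOn_tet hk T.2 hA a ha, h.interp_eqOn_tet hk T.2 hA b hb]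
    exact hAK a b

lemma exists_lipschitzWith_affineMap (A : R3 →ᵃ[ℝ] R3) : ∃ K, LipschitzWith K A := by
  refine ⟨‖LinearMap.toContinuousLinearMap A.linear‖₊, LipschitzWith.of_dist_le_mul fun x y => ?_⟩
  have := (LinearMap.toContinuousLinearMap A.linear).lipschitz.dist_le_mul x y
  rw [A.decomp]
  simpa using this

/-! ### Bond volumes in relative coordinates. -/

/-- Coordinates of `x` relative to the box with main diagonal from `x_ℓ` to `x_{ℓ+η}`. -/
def relCoord (k : ℕ) (ℓ η : Lat) (x : R3) (i : Fin 3) : ℝ := (k * x i - ℓ i) / η i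

lemma div_mem_Icc_iff_of_neg {a c : ℝ} (hc : c < 0) : a / c ∈ Icc 0 1 ↔ c ≤ a ∧ a ≤ 0 := by
  rw [mem_Icc, le_div_iff_of_neg hc, div_le_iff_of_neg hc, zero_mul, one_mul, and_comm]

lemma div_mem_Icc_iff_of_pos {a c : ℝ} (hc : 0 < c) : a / c ∈ Icc 0 1 ↔ 0 ≤ a ∧ a ≤ c := by
  rw [mem_Icc, le_div_iff₀ hc, div_le_iff₀ hc, zero_mul, one_mul]

lemma div_mem_Ioo_iff_of_neg {a c : ℝ} (hc : c < 0) : a / c ∈ Ioo 0 1 ↔ c < a ∧ a < 0 := by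
  rw [mem_Ioo, lt_div_iff_of_neg hc, div_lt_iff_of_neg hc, zero_mul, one_mul, and_comm]

lemma div_mem_Ioo_iff_of_pos {a c : ℝ} (hc : 0 < c) : a / c ∈ Ioo 0 1 ↔ 0 < a ∧ a < c := by
  rw [mem_Ioo, lt_div_iff₀ hc, div_lt_iff₀ hc, zero_mul, one_mul]

lemma relCoord_pos (hk : 0 < k) (ℓ η p : Lat) (i : Fin 3) :
    relCoord k ℓ η (pos k p) i = ((p i : ℝ) - ℓ i) / η i := by
  rw [relCoord, mul_pos_apply hk]

lemma mem_bondVolume_iff (hk : 0 < k) {ℓ η : Lat} {x : R3} :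
    x ∈ bondVolume k ℓ η ↔ ∀ i, ((min (ℓ i) (ℓ i + η i) : ℤ) : ℝ) < k * x i ∧
      k * x i < ((max (ℓ i) (ℓ i + η i) : ℤ) : ℝ) := by
  have hk' : (0 : ℝ) < k := by positivity
  simp only [bondVolume, mem_univ_pi, mem_Ioo, pos, Pi.add_apply]
  refine forall_congr' fun i => ?_
  rw [min_div_div_right hk'.le, max_div_div_right hk'.le, div_lt_iff₀' hk', lt_div_iff₀' hk']
  push_cast
  rfl

lemma mem_bondVolume_iff_relCoord (hk : 0 < k) {ℓ η : Lat} (hη : ∀ i, η i ≠ 0) {x : R3} :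
    x ∈ bondVolume k ℓ η ↔ ∀ i, relCoord k ℓ η x i ∈ Ioo 0 1 := by
  rw [mem_bondVolume_iff hk]
  refine forall_congr' fun i => ?_
  rcases lt_or_gt_of_ne (hη i) with h | h
  · have h' : (η i : ℝ) < 0 := by exact_mod_cast h
    rw [min_eq_right (by omega), max_eq_left (by omega), relCoord,
      div_mem_Ioo_iff_of_neg h']
    push_cast
    constructor <;> rintro ⟨h1, h2⟩ <;> constructor <;> linarith
  · have h' : (0 : ℝ) < η i := by exact_mod_cast h
    rw [min_eq_left (by omega), max_eq_right (by omega), relCoord,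
      div_mem_Ioo_iff_of_pos h']
    push_cast
    constructor <;> rintro ⟨h1, h2⟩ <;> constructor <;> linarith

lemma closure_bondVolume (hk : 0 < k) {ℓ η : Lat} (hη : ∀ i, η i ≠ 0) :
    closure (bondVolume k ℓ η) = univ.pi fun i => uIcc (pos k ℓ i) (pos k (ℓ + η) i) := by
  have hk' : (k : ℝ) ≠ 0 := by positivity
  rw [bondVolume, closure_pi_set]
  refine Set.pi_congr rfl fun i _ => ?_
  rw [closure_Ioo]
  · rfl
  · intro h
    replace h := inf_eq_sup.1 h
    simp only [pos, Pi.add_apply] at h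
    field_simp at h
    exact hη i (by exact_mod_cast (left_eq_add.1 (by exact_mod_cast h : ℓ i = ℓ i + η i)))

lemma mem_closure_bondVolume_iff (hk : 0 < k) {ℓ η : Lat} (hη : ∀ i, η i ≠ 0) {x : R3} :
    x ∈ closure (bondVolume k ℓ η) ↔ ∀ i, relCoord k ℓ η x i ∈ Icc 0 1 := by
  have hk' : (0 : ℝ) < k := by positivity
  rw [closure_bondVolume hk hη]
  simp only [mem_univ_pi]
  refine forall_congr' fun i => ?_
  rcases lt_or_gt_of_ne (hη i) with h | h
  · have h' : (η i : ℝ) < 0 := by exact_mod_cast h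
    rw [uIcc_of_ge (by simp only [pos, Pi.add_apply]; gcongr; omega), relCoord, mem_Icc,
      div_mem_Icc_iff_of_neg h']
    simp only [pos, Pi.add_apply]
    rw [div_le_iff₀' hk', le_div_iff₀' hk']
    push_cast
    constructor <;> rintro ⟨h1, h2⟩ <;> constructor <;> linarith
  · have h' : (0 : ℝ) < η i := by exact_mod_cast h
    rw [uIcc_of_le (by simp only [pos, Pi.add_apply]; gcongr; omega), relCoord, mem_Icc,
      div_mem_Icc_iff_of_pos h']
    simp only [pos, Pi.add_apply]
    rw [div_le_iff₀' hk', le_div_iff₀' hk']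
    push_cast
    constructor <;> rintro ⟨h1, h2⟩ <;> constructor <;> linarith

lemma convex_closure_bondVolume (hk : 0 < k) {ℓ η : Lat} (hη : ∀ i, η i ≠ 0) :
    Convex ℝ (closure (bondVolume k ℓ η)) := by
  rw [closure_bondVolume hk hη]
  exact convex_pi fun i _ => convex_uIcc _ _

lemma abs_sub_le_of_mem_closure_bondVolume (hk : 0 < k) {ℓ η p q : Lat} (hη : ∀ i, η i ≠ 0)
    (hp : pos k p ∈ closure (bondVolume k ℓ η)) (hq : pos k q ∈ closure (bondVolume k ℓ η))
    (i : Fin 3) : |p i - q i| ≤ |η i| := by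
  rw [mem_closure_bondVolume_iff hk hη] at hp hq
  have h1 := hp i
  have h2 := hq i
  rw [relCoord_pos hk] at h1 h2
  have h' : (η i : ℝ) ≠ 0 := by exact_mod_cast hη i
  have e : ((p i : ℝ) - q i) = (((p i : ℝ) - ℓ i) / η i - ((q i : ℝ) - ℓ i) / η i) * η i := by
    field_simp
    ring
  have : |((p i : ℝ) - q i)| ≤ |(η i : ℝ)| := by
    rw [e, abs_mul]
    refine mul_le_of_le_one_left (abs_nonneg _) (abs_le.2 ⟨?_, ?_⟩) <;>
    linarith [h1.1, h1.2, h2.1, h2.2]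
  exact_mod_cast this

/-! ### Type A decompositions. -/

/-- The vertices of the tetrahedron of the type A decomposition that belongs to `σ`. -/
def chainVertex (ℓ η : Lat) (σ : Equiv.Perm (Fin 3)) (j : ℕ) : Lat :=
  fun i => ℓ i + if (σ i).val < j then η i else 0

def chainSimplex (ℓ η : Lat) (σ : Equiv.Perm (Fin 3)) : Finset Lat :=
  (Finset.range 4).image (chainVertex ℓ η σ)

lemma mem_typeA_iff {ℓ η : Lat} {T : Finset Lat} :
    T ∈ typeA ℓ η ↔ ∃ σ, T = chainSimplex ℓ η σ := by
  have : ∀ σ : Equiv.Perm (Fin 3), (Finset.univ.image fun j : Fin 4 => fun i =>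
      ℓ i + if (σ i).val < j.val then η i else 0) = chainSimplex ℓ η σ := by
    intro σ
    ext p
    simp only [chainSimplex, Finset.mem_image, Finset.mem_univ, true_and, Finset.mem_range]
    exact ⟨fun ⟨j, hj⟩ => ⟨j, j.2, hj⟩, fun ⟨j, hj, h⟩ => ⟨⟨j, hj⟩, h⟩⟩
  simp only [typeA, Finset.mem_image, Finset.mem_univ, true_and, this, eq_comm]

lemma chainVertex_zero (ℓ η : Lat) (σ : Equiv.Perm (Fin 3)) : chainVertex ℓ η σ 0 = ℓ := by
  funext i; simp [chainVertex]

lemma chainVertex_three (ℓ η : Lat) (σ : Equiv.Perm (Fin 3)) : chainVertex ℓ η σ 3 = ℓ + η := by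
  funext i; simp [chainVertex]

lemma chainVertex_mem {ℓ η : Lat} {σ : Equiv.Perm (Fin 3)} {j : ℕ} (hj : j < 4) :
    chainVertex ℓ η σ j ∈ chainSimplex ℓ η σ :=
  Finset.mem_image_of_mem _ (Finset.mem_range.2 hj)

lemma sum_chainSimplex {E : Type*} [AddCommMonoid E] {ℓ η : Lat} (hη : ∀ i, η i ≠ 0)
    (σ : Equiv.Perm (Fin 3)) (f : Lat → E) :
    ∑ p ∈ chainSimplex ℓ η σ, f p = ∑ j ∈ Finset.range 4, f (chainVertex ℓ η σ j) := by
  refine Finset.sum_image ?_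
  have key : ∀ a b : ℕ, a < b → b < 4 → chainVertex ℓ η σ a ≠ chainVertex ℓ η σ b := by
    intro a b hab hb h
    have := congrFun h (σ.symm ⟨a, by omega⟩)
    simp only [chainVertex, Equiv.apply_symm_apply, lt_irrefl, if_false, if_pos hab] at this
    simp [hη] at this
  intro a ha b hb h
  simp only [Finset.coe_range, mem_Iio] at ha hb
  rcases lt_trichotomy a b with hab | hab | hab
  · exact (key a b hab hb h).elim
  · exact hab
  · exact (key b a hab ha h.symm).elim

lemma relCoord_chainVertex (hk : 0 < k) {ℓ η : Lat} (hη : ∀ i, η i ≠ 0) (σ : Equiv.Perm (Fin 3))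
    (j : ℕ) (i : Fin 3) :
    relCoord k ℓ η (pos k (chainVertex ℓ η σ j)) i = if (σ i).val < j then 1 else 0 := by
  have h' : (η i : ℝ) ≠ 0 := by exact_mod_cast hη i
  rw [relCoord_pos hk, chainVertex]
  split_ifs <;> simp [h']

lemma tet_subset {T : Finset Lat} {C : Set R3} (hC : Convex ℝ C) (h : ∀ p ∈ T, pos k p ∈ C) :
    tet k T ⊆ C := by
  refine convexHull_min ?_ hC
  rintro _ ⟨p, hp, rfl⟩
  exact h p hp

lemma tet_subset_of_mem_typeA (hk : 0 < k) {ℓ η : Lat} (hη : ∀ i, η i ≠ 0) {T : Finset Lat}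
    (hT : T ∈ typeA ℓ η) : tet k T ⊆ closure (bondVolume k ℓ η) := by
  obtain ⟨σ, rfl⟩ := mem_typeA_iff.1 hT
  refine tet_subset (convex_closure_bondVolume hk hη) fun p hp => ?_
  obtain ⟨j, -, rfl⟩ := Finset.mem_image.1 hp
  rw [mem_closure_bondVolume_iff hk hη]
  intro i
  rw [relCoord_chainVertex hk hη]
  split_ifs <;> simp

/-- The affine function that interpolates `y` on a tetrahedron of the type A decomposition. -/
def chainMap (k : ℕ) (ℓ η : Lat) (σ : Equiv.Perm (Fin 3)) (y : Lat → R3) : R3 →ᵃ[ℝ] R3 :=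
  let d : Fin 3 → R3 := fun i =>
    y (chainVertex ℓ η σ ((σ i).val + 1)) - y (chainVertex ℓ η σ (σ i).val)
  (∑ i, (LinearMap.proj i : R3 →ₗ[ℝ] ℝ).smulRight (((k : ℝ) / η i) • d i)).toAffineMap +
    AffineMap.const ℝ R3 (y ℓ - ∑ i, ((ℓ i : ℝ) / η i) • d i)

/-- Direction `i` is traversed at step `σ i` of the chain, so the relative coordinate `i` multiplies
the increment of `y` along that edge. At a vertex of the chain the sum telescopes. -/
lemma chainMap_apply (ℓ η : Lat) (σ : Equiv.Perm (Fin 3)) (y : Lat → R3) (x : R3) :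
    chainMap k ℓ η σ y x = y ℓ + ∑ i, relCoord k ℓ η x i •
      (y (chainVertex ℓ η σ ((σ i).val + 1)) - y (chainVertex ℓ η σ (σ i).val)) := by
  simp only [chainMap, AffineMap.coe_add, LinearMap.coe_toAffineMap, Pi.add_apply,
    LinearMap.sum_apply, LinearMap.smulRight_apply, LinearMap.proj_apply, AffineMap.const_apply,
    relCoord, sub_div, sub_smul, Finset.sum_sub_distrib, smul_smul]
  simp only [mul_comm (k : ℝ), mul_div_assoc]
  abel

lemma chainMap_vertex (hk : 0 < k) {ℓ η : Lat} (hη : ∀ i, η i ≠ 0) (σ : Equiv.Perm (Fin 3))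
    (y : Lat → R3) {p : Lat} (hp : p ∈ chainSimplex ℓ η σ) :
    chainMap k ℓ η σ y (pos k p) = y p := by
  obtain ⟨j, hj, rfl⟩ := Finset.mem_image.1 hp
  rw [Finset.mem_range] at hj
  rw [chainMap_apply]
  simp only [relCoord_chainVertex hk hη]
  rw [Equiv.sum_comp σ fun m => (if m.val < j then (1 : ℝ) else 0) •
    (y (chainVertex ℓ η σ (m.val + 1)) - y (chainVertex ℓ η σ m.val)), Fin.sum_univ_three]
  nth_rewrite 1 [← chainVertex_zero ℓ η σ]
  interval_cases j <;> simp

lemma interpolable_of_mem_typeA (hk : 0 < k) {ℓ η : Lat} (hη : ∀ i, η i ≠ 0) {T : Finset Lat}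
    (hT : T ∈ typeA ℓ η) : Interpolable k T := by
  obtain ⟨σ, rfl⟩ := mem_typeA_iff.1 hT
  exact fun y => ⟨chainMap k ℓ η σ y, fun p hp => chainMap_vertex hk hη σ y hp⟩

/-- The constant comes from three coordinates, each `k`-Lipschitz, times increments of norm at most
`2 * C`. -/
lemma lipschitzWith_chainMap (ℓ : Lat) (σ : Equiv.Perm (Fin 3)) {y : Lat → R3} {C : NNReal}
    (hC : ∀ p, ‖y p‖ ≤ C) : LipschitzWith (6 * k * C) (chainMap k ℓ 1 σ y) := by
  refine LipschitzWith.of_dist_le_mul fun x z => ?_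
  rw [chainMap_apply, chainMap_apply, dist_add_left, dist_eq_norm, ← Finset.sum_sub_distrib]
  have h : ∀ i ∈ (Finset.univ : Finset (Fin 3)), ‖relCoord k ℓ 1 x i •
      (y (chainVertex ℓ 1 σ ((σ i).val + 1)) - y (chainVertex ℓ 1 σ (σ i).val)) -
      relCoord k ℓ 1 z i •
      (y (chainVertex ℓ 1 σ ((σ i).val + 1)) - y (chainVertex ℓ 1 σ (σ i).val))‖ ≤
      (k * dist x z) * (C + C) := by
    intro i _
    rw [← sub_smul, norm_smul]
    refine mul_le_mul ?_ ((norm_sub_le _ _).trans (add_le_add (hC _) (hC _))) (norm_nonneg _)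
      (by positivity)
    have : relCoord k ℓ 1 x i - relCoord k ℓ 1 z i = k * (x i - z i) := by
      simp only [relCoord, Pi.one_apply, Int.cast_one, div_one]; ring
    rw [this, norm_mul, Real.norm_natCast]
    gcongr
    exact (Real.dist_eq _ _).symm.trans_le (dist_le_pi_dist x z i)
  refine (norm_sum_le_of_le _ h).trans (le_of_eq ?_)
  simp
  ring

lemma integral_of_eq_const_Ioo {f : ℝ → R3} {a b : ℝ} {c : R3} (hab : a ≤ b)
    (h : ∀ s ∈ Ioo a b, f s = c) :
    IntervalIntegrable f volume a b ∧ ∫ s in a..b, f s = (b - a) • c := by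
  have e : EqOn (fun _ => c) f (uIoo a b) := by
    rw [uIoo_of_le hab]; exact fun s hs => (h s hs).symm
  refine ⟨(intervalIntegrable_const (μ := volume) (a := a) (b := b) (c := c)).congr_uIoo e, ?_⟩
  rw [← intervalIntegral.integral_congr_uIoo e, intervalIntegral.integral_const]

/-- The interpolant on a type A decomposition is a mean value of lattice values. -/
lemma sum_chainSimplex_eq_integral (hk : 0 < k) {ℓ η : Lat} (hη : ∀ i, η i ≠ 0)
    (σ : Equiv.Perm (Fin 3)) {w : Lat → ℝ} {x : R3} (hw : IsBarycentric k (chainSimplex ℓ η σ) w x)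
    (r n : Lat) (hr : ∀ i, ℓ i = r i + η i * n i) (y : Lat → R3) :
    ∑ p ∈ chainSimplex ℓ η σ, w p • y p =
      ∫ s in (0 : ℝ)..1, y fun i => r i + η i * ⌊relCoord k r η x i + s⌋ := by
  obtain ⟨w0, w1, w2⟩ := hw
  rw [sum_chainSimplex hη] at w1 w2 ⊢
  set a : ℕ → ℝ := fun j => w (chainVertex ℓ η σ j) with ha
  have a0 : ∀ j < 4, 0 ≤ a j := fun j hj => w0 _ (chainVertex_mem hj)
  set W : ℕ → ℝ := fun m => ∑ j ∈ Finset.range m, a j with hW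
  have W4 : W 4 = 1 := w1
  have W0 : W 0 = 0 := by simp [hW]
  have Wsucc : ∀ m, W (m + 1) = W m + a m := fun m => Finset.sum_range_succ _ _
  have Wmono : ∀ m m', m ≤ m' → m' ≤ 4 → W m ≤ W m' := by
    intro m m' h h4
    refine Finset.sum_le_sum_of_subset_of_nonneg (Finset.range_mono h) fun j hj _ => a0 j ?_
    rw [Finset.mem_range] at hj
    omega
  -- Direction `i` has been traversed exactly at the vertices with index above `σ i`. Their total
  -- weight `1 - W (σ i + 1)` is the relative coordinate with respect to `ℓ`, and `n` accounts for
  -- the change of origin to `r`.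
  have hrel : ∀ i, relCoord k r η x i = n i + (1 - W ((σ i).val + 1)) := by
    intro i
    have h' : (η i : ℝ) ≠ 0 := by exact_mod_cast hη i
    have hx : (k : ℝ) * x i = ℓ i + η i * (1 - W ((σ i).val + 1)) := by
      rw [← w2, Finset.sum_apply, Finset.mul_sum]
      have : ∀ j ∈ Finset.range 4,
          (k : ℝ) * (w (chainVertex ℓ η σ j) • pos k (chainVertex ℓ η σ j)) i
          = a j * ℓ i + η i * (if (σ i).val < j then a j else 0) := by
        intro j _
        rw [Pi.smul_apply, smul_eq_mul, mul_left_comm, mul_pos_apply hk]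
        simp only [chainVertex, ha]
        split_ifs <;> push_cast <;> ring
      rw [Finset.sum_congr rfl this, Finset.sum_add_distrib, ← Finset.sum_mul, ← Finset.mul_sum,
        show ∑ j ∈ Finset.range 4, a j = 1 from w1, one_mul]
      congr 2
      have h4 := W4
      simp only [hW] at h4 ⊢
      generalize σ i = m
      fin_cases m <;> simp [Finset.sum_range_succ] at h4 ⊢ <;> linarith
    rw [relCoord, hx, hr i]
    push_cast
    field_simp
    ring
  set f : ℝ → R3 := fun s => y fun i => r i + η i * ⌊relCoord k r η x i + s⌋ with hf
  -- The floor in direction `i` jumps from `n i` to `n i + 1` at `s = W (σ i + 1)`. Between `W m`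
  -- and `W (m + 1)` exactly the first `m` directions have jumped, which gives vertex `m` on an
  -- interval whose length is its weight.
  have hpiece : ∀ m < 4, ∀ s ∈ Ioo (W m) (W (m + 1)), f s = y (chainVertex ℓ η σ m) := by
    intro m hm s hs
    simp only [hf]
    congr 1
    funext i
    have hs0 : 0 ≤ s := W0 ▸ (Wmono 0 m (by omega) (by omega)).trans hs.1.le
    have hs1 : s < 1 := W4 ▸ hs.2.trans_le (Wmono (m + 1) 4 (by omega) le_rfl)
    have hσ := (σ i).2
    have hW1 : W ((σ i).val + 1) ≤ 1 := W4 ▸ Wmono _ 4 (by omega) le_rfl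
    have hW0 : 0 ≤ W ((σ i).val + 1) := W0 ▸ Wmono 0 _ (by omega) (by omega)
    rw [hrel, chainVertex, hr i]
    split_ifs with h
    · have hle := Wmono ((σ i).val + 1) m (by omega) (by omega)
      have : ⌊(n i : ℝ) + (1 - W ((σ i).val + 1)) + s⌋ = n i + 1 := by
        rw [Int.floor_eq_iff]
        push_cast
        constructor <;> linarith [hs.1]
      rw [this]
      ring
    · have hle := Wmono (m + 1) ((σ i).val + 1) (by omega) (by omega)
      have : ⌊(n i : ℝ) + (1 - W ((σ i).val + 1)) + s⌋ = n i := by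
        rw [Int.floor_eq_iff]
        constructor <;> linarith [hs.2]
      rw [this]
      ring
  have hint := fun m (hm : m < 4) =>
    integral_of_eq_const_Ioo (Wmono m (m + 1) (by omega) (by omega)) (hpiece m hm)
  have hsum := intervalIntegral.sum_integral_adjacent_intervals (f := f) (μ := volume) (a := W)
    (n := 4) fun m hm => (hint m hm).1
  rw [W0, W4] at hsum
  rw [← hsum]
  refine Finset.sum_congr rfl fun m hm => ?_
  rw [(hint m (Finset.mem_range.1 hm)).2, Wsucc, add_sub_cancel_left]

/-- The integral formula with origin `ℓ` involves the point `x` but neither the tetrahedron nor the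
translate of the box by multiples of `η`. -/
lemma agree_of_mem_typeA (hk : 0 < k) {ℓ ℓ' η : Lat} (hη : ∀ i, η i ≠ 0)
    (hℓ : ∀ i, η i ∣ ℓ' i - ℓ i) {T T' : Finset Lat} (hT : T ∈ typeA ℓ η) (hT' : T' ∈ typeA ℓ' η) :
    Agree k T T' := by
  obtain ⟨σ, rfl⟩ := mem_typeA_iff.1 hT
  obtain ⟨σ', rfl⟩ := mem_typeA_iff.1 hT'
  choose n hn using hℓ
  intro x w w' hw hw' y
  rw [sum_chainSimplex_eq_integral hk hη σ hw ℓ 0 (by simp),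
    sum_chainSimplex_eq_integral hk hη σ' hw' ℓ n fun i => by rw [← hn]; ring]

/-- Listing the relative coordinates in decreasing order gives the order of the directions; their
consecutive differences, completed by 1 and 0 at the ends, are the barycentric weights. -/
lemma exists_mem_typeA (hk : 0 < k) {ℓ η : Lat} (hη : ∀ i, η i ≠ 0) {x : R3}
    (hx : x ∈ closure (bondVolume k ℓ η)) : ∃ T ∈ typeA ℓ η, x ∈ tet k T := by
  rw [mem_closure_bondVolume_iff hk hη] at hx
  set ξ := relCoord k ℓ η x with hξ
  set τ := Tuple.sort fun i => -ξ i with hτ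
  have hanti : ∀ a b : Fin 3, a ≤ b → ξ (τ b) ≤ ξ (τ a) := fun a b hab =>
    neg_le_neg_iff.1 (Tuple.monotone_sort (fun i => -ξ i) hab)
  refine ⟨_, mem_typeA_iff.2 ⟨τ.symm, rfl⟩, ?_⟩
  let a : Fin 4 → ℝ := ![1 - ξ (τ 0), ξ (τ 0) - ξ (τ 1), ξ (τ 1) - ξ (τ 2), ξ (τ 2)]
  have hmem : ∑ j, a j • pos k (chainVertex ℓ η τ.symm j.val) ∈
      tet k (chainSimplex ℓ η τ.symm) := by
    refine (convex_tet _).sum_mem (fun j _ => ?_) ?_ fun j _ => pos_mem_tet (chainVertex_mem j.2)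
    · have h0 := hanti 0 1 (by decide)
      have h1 := hanti 1 2 (by decide)
      have h2 := (hx (τ 0)).2
      have h3 := (hx (τ 2)).1
      fin_cases j <;> simp [a] <;> linarith
    · simp [a, Fin.sum_univ_four]
  convert hmem
  funext i
  have hk' : (k : ℝ) ≠ 0 := by positivity
  have hη' : (η i : ℝ) ≠ 0 := by exact_mod_cast hη i
  have hxi : x i = (ℓ i + η i * ξ i) / k := by
    rw [hξ, relCoord]
    field_simp
    ring
  rw [hxi]
  obtain ⟨m, rfl⟩ := τ.surjective i
  simp only [Finset.sum_apply, Pi.smul_apply, smul_eq_mul, pos, chainVertex,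
    Equiv.symm_apply_apply, Fin.sum_univ_four, a]
  fin_cases m <;> simp <;> ring

/-! ### The mesh of the lattice cells. -/

lemma one_apply_ne_zero (i : Fin 3) : (1 : Lat) i ≠ 0 := one_ne_zero

lemma isMesh_cellTets (hk : 0 < k) : IsMesh k cellTets where
  interpolable := fun _ ⟨_, hT⟩ => interpolable_of_mem_typeA hk one_apply_ne_zero hT
  agree := fun _ ⟨_, hT⟩ _ ⟨_, hT'⟩ =>
    agree_of_mem_typeA hk one_apply_ne_zero (fun _ => one_dvd _) hT hT'

lemma abs_sub_le_of_mem_cellTets {T : Finset Lat} (hT : T ∈ cellTets) {p q : Lat} (hp : p ∈ T)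
    (hq : q ∈ T) (i : Fin 3) : |p i - q i| ≤ 1 := by
  obtain ⟨ℓ, hT⟩ := hT
  -- The claim concerns indices only, so the lattice spacing may be taken to be one.
  have hs := tet_subset_of_mem_typeA (k := 1) one_pos one_apply_ne_zero hT
  exact abs_sub_le_of_mem_closure_bondVolume one_pos one_apply_ne_zero (hs (pos_mem_tet hp))
    (hs (pos_mem_tet hq)) i

/-- The closed lattice cell of a point. -/
lemma mem_closure_cell (hk : 0 < k) (x : R3) :
    x ∈ closure (bondVolume k (fun i => ⌊(k : ℝ) * x i⌋) 1) := by
  rw [mem_closure_bondVolume_iff hk one_apply_ne_zero]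
  intro i
  simp only [relCoord, Pi.one_apply, Int.cast_one, div_one, mem_Icc]
  constructor
  · linarith [Int.floor_le ((k : ℝ) * x i)]
  · linarith [Int.lt_floor_add_one ((k : ℝ) * x i)]

lemma exists_mem_cellTets (hk : 0 < k) (x : R3) : ∃ T ∈ cellTets, x ∈ tet k T := by
  obtain ⟨T, hT, hx⟩ := exists_mem_typeA hk one_apply_ne_zero (mem_closure_cell hk x)
  exact ⟨T, ⟨_, hT⟩, hx⟩

/-- A formula for the cell interpolant that is visibly compatible with lattice translations; it
yields the periodicity. -/
lemma interp_cellTets_eq_integral (hk : 0 < k) (y : Lat → R3) (x : R3) :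
    interp k cellTets y x = ∫ s in (0 : ℝ)..1, y fun i => ⌊(k : ℝ) * x i + s⌋ := by
  obtain ⟨T, ⟨ℓ, hT⟩, hx⟩ := exists_mem_cellTets hk x
  obtain ⟨w, hw⟩ := (mem_tet_iff hk).1 hx
  rw [(isMesh_cellTets hk).interp_eq ⟨ℓ, hT⟩ hw]
  obtain ⟨σ, rfl⟩ := mem_typeA_iff.1 hT
  rw [sum_chainSimplex_eq_integral hk one_apply_ne_zero σ hw 0 ℓ (by simp)]
  simp [relCoord]

lemma exists_chainMap_of_mem_cellTets (hk : 0 < k) {y : Lat → R3} {C : NNReal}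
    (hC : ∀ p, ‖y p‖ ≤ C) {T : Finset Lat} (hT : T ∈ cellTets) :
    ∃ A : R3 →ᵃ[ℝ] R3, (∀ p ∈ T, A (pos k p) = y p) ∧ LipschitzWith (6 * k * C) A := by
  obtain ⟨ℓ, hT⟩ := hT
  obtain ⟨σ, rfl⟩ := mem_typeA_iff.1 hT
  exact ⟨chainMap k ℓ 1 σ y, fun p hp => chainMap_vertex hk one_apply_ne_zero σ y hp,
    lipschitzWith_chainMap ℓ σ hC⟩

lemma lipschitzWith_interp_cellTets (hk : 0 < k) {y : Lat → R3} {C : NNReal}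
    (hC : ∀ p, ‖y p‖ ≤ C) : LipschitzWith (6 * k * C) (interp k cellTets y) :=
  (isMesh_cellTets hk).lipschitzWith hk (D := 1)
    (fun _ hT _ hp _ hq i => by exact_mod_cast abs_sub_le_of_mem_cellTets hT hp hq i)
    (exists_mem_cellTets hk) fun _ hT => exists_chainMap_of_mem_cellTets hk hC hT

lemma locallyFinite_cellTets (hk : 0 < k) :
    LocallyFinite fun T : (cellTets : Set (Finset Lat)) => tet k (T : Finset Lat) :=
  locallyFinite_tet hk (D := 1)
    (fun _ hT _ hp _ hq i => by exact_mod_cast abs_sub_le_of_mem_cellTets hT hp hq i)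

lemma isClosed_biUnion_cellTets (hk : 0 < k) {S : Set (Finset Lat)} (hS : S ⊆ cellTets) :
    IsClosed (⋃ T ∈ S, tet k T) := by
  rw [biUnion_eq_iUnion]
  exact ((locallyFinite_cellTets hk).comp_injective (inclusion_injective hS)).isClosed_iUnion
    fun _ => isClosed_tet _

lemma finite_cellTets_inter (hk : 0 < k) {C : Set R3} (hC : IsCompact C) :
    {T | T ∈ cellTets ∧ (tet k T ∩ C).Nonempty}.Finite := by
  refine (((locallyFinite_cellTets hk).finite_nonempty_inter_compact hC).image
    fun T : (cellTets : Set (Finset Lat)) => (T : Finset Lat)).subset ?_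
  rintro T ⟨hT, hTC⟩
  exact ⟨⟨T, hT⟩, hTC, rfl⟩

/-- A bond volume is filled by the tetrahedra of the lattice cells in it. -/
lemma exists_mem_cellTets_subset (hk : 0 < k) {ℓ η : Lat} (hη : ∀ i, η i ≠ 0) {x : R3}
    (hx : x ∈ closure (bondVolume k ℓ η)) :
    ∃ T ∈ cellTets, tet k T ⊆ closure (bondVolume k ℓ η) ∧ x ∈ tet k T := by
  have hcl : IsClosed (⋃ T ∈ {T | T ∈ cellTets ∧ tet k T ⊆ closure (bondVolume k ℓ η)}, tet k T) :=
    isClosed_biUnion_cellTets hk fun T hT => hT.1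
  -- For a point of the open box, the cell given by the floors stays inside the closed box, since
  -- the faces of the box are lattice planes. On the boundary that cell may lie outside, so those
  -- points are reached by closure.
  have hsub : bondVolume k ℓ η ⊆
      ⋃ T ∈ {T | T ∈ cellTets ∧ tet k T ⊆ closure (bondVolume k ℓ η)}, tet k T := by
    intro z hz
    obtain ⟨T, hT, hzT⟩ := exists_mem_typeA hk one_apply_ne_zero (mem_closure_cell hk z)
    refine mem_iUnion₂.2 ⟨T, ⟨⟨_, hT⟩, ?_⟩, hzT⟩
    refine tet_subset (convex_closure_bondVolume hk hη) fun p hp => ?_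
    have hp' := (mem_closure_bondVolume_iff hk one_apply_ne_zero).1
      (tet_subset_of_mem_typeA hk one_apply_ne_zero hT (pos_mem_tet hp))
    rw [mem_closure_bondVolume_iff hk hη]
    intro i
    have h1 := hp' i
    rw [relCoord_pos hk] at h1 ⊢
    simp only [Pi.one_apply, Int.cast_one, div_one, mem_Icc] at h1
    obtain ⟨hz1, hz2⟩ := (mem_bondVolume_iff hk).1 hz i
    have h2 := Int.le_floor.2 hz1.le
    have h3 := Int.floor_lt.2 hz2
    have h4 : ⌊(k : ℝ) * z i⌋ ≤ p i := by exact_mod_cast sub_nonneg.1 h1.1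
    have h5 : p i ≤ ⌊(k : ℝ) * z i⌋ + 1 := by
      have := h1.2
      rw [sub_le_iff_le_add'] at this
      exact_mod_cast this
    rcases lt_or_gt_of_ne (hη i) with h | h
    · have h' : (η i : ℝ) < 0 := by exact_mod_cast h
      rw [min_eq_right (by omega)] at h2
      rw [max_eq_left (by omega)] at h3
      rw [div_mem_Icc_iff_of_neg h', and_comm]
      constructor
      · exact_mod_cast (by omega : p i - ℓ i ≤ 0)
      · exact_mod_cast (by omega : η i ≤ p i - ℓ i)
    · have h' : (0 : ℝ) < η i := by exact_mod_cast h
      rw [min_eq_left (by omega)] at h2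
      rw [max_eq_right (by omega)] at h3
      rw [div_mem_Icc_iff_of_pos h']
      constructor
      · exact_mod_cast (by omega : 0 ≤ p i - ℓ i)
      · exact_mod_cast (by omega : p i - ℓ i ≤ η i)
  obtain ⟨T, hT, hxT⟩ := mem_iUnion₂.1 (closure_minimal hsub hcl hx)
  exact ⟨T, hT.1, hT.2, hxT⟩

lemma interpolable_of_affineIndependent {T : Finset Lat} (hc : T.card = 4)
    (h : AffineIndependent ℝ fun p : T => pos k (p : Lat)) : Interpolable k T := by
  have htop : affineSpan ℝ (range fun p : T => pos k (p : Lat)) = ⊤ := by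
    rw [h.affineSpan_eq_top_iff_card_eq_finrank_add_one]
    simp [hc]
  let b : AffineBasis T ℝ R3 := ⟨_, h, htop⟩
  intro y
  refine ⟨∑ q : T, ((LinearMap.id.smulRight (y q) : ℝ →ₗ[ℝ] R3).toAffineMap).comp (b.coord q), ?_⟩
  intro p hp
  have e : ∀ q : T, b.coord q (pos k p) = if q = ⟨p, hp⟩ then 1 else 0 := fun q =>
    b.coord_apply q ⟨p, hp⟩
  have : ∀ (s : Finset T) (f : T → R3 →ᵃ[ℝ] R3) (x : R3), (∑ q ∈ s, f q) x = ∑ q ∈ s, f q x := by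
    intro s f x
    induction s using Finset.cons_induction with
    | empty => rfl
    | cons a s ha ih => rw [Finset.sum_cons, Finset.sum_cons, ← ih]; rfl
  rw [this]
  simp [e]

/-! ### Differentiation of integral functionals and integrals of gradients of Lipschitz functions.
-/

/-- Here `ψ` is arbitrary. Potentials that are differentiable at a single point, and possibly not
even measurable, can thus be handled by finite sums instead of dominated convergence. -/
lemma integral_comp_of_ae_mem_finset {X E F : Type*} [MeasurableSpace X] {μ : Measure X}
    [IsFiniteMeasure μ] [MeasurableSpace E] [MeasurableSingletonClass E] [NormedAddCommGroup F]
    [NormedSpace ℝ F] [CompleteSpace F] {g : X → E} (hg : Measurable g) {V : Finset E}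
    (hV : ∀ᵐ x ∂μ, g x ∈ V) (ψ : E → F) :
    ∫ x, ψ (g x) ∂μ = ∑ c ∈ V, μ.real (g ⁻¹' {c}) • ψ c := by
  classical
  have hm : ∀ c, MeasurableSet (g ⁻¹' {c}) := fun c => hg (measurableSet_singleton c)
  have e : (fun x => ψ (g x)) =ᵐ[μ] fun x => ∑ c ∈ V, (g ⁻¹' {c}).indicator (fun _ => ψ c) x := by
    filter_upwards [hV] with x hx
    rw [Finset.sum_eq_single_of_mem (g x) hx]
    · rw [indicator_of_mem (by simp)]
    · intro c _ hc
      exact indicator_of_notMem (fun h => hc (by simpa using h.symm)) _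
  rw [integral_congr_ae e, integral_finsetSum]
  · exact Finset.sum_congr rfl fun c _ => integral_indicator_const _ (hm c)
  · exact fun c _ => (integrable_const _).indicator (hm c)

/-- Derivative of an integral functional at a homogeneous state, in the direction of a function
that has finitely many values. -/
lemma hasDerivAt_integral_of_ae_mem_finset {X : Type*} [MeasurableSpace X] {μ : Measure X}
    [IsFiniteMeasure μ] {g : X → R3} (hg : Measurable g) {V : Finset R3}
    (hV : ∀ᵐ x ∂μ, g x ∈ V) {φ : R3 → ℝ} {p : R3} {L : R3 →L[ℝ] ℝ} (hφ : HasFDerivAt φ L p) :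
    HasDerivAt (fun t : ℝ => ∫ x, φ (p + t • g x) ∂μ) (L (∫ x, g x ∂μ)) 0 := by
  have h : ∀ t : ℝ, ∫ x, φ (p + t • g x) ∂μ =
      ∑ c ∈ V, μ.real (g ⁻¹' {c}) • φ (p + t • c) := fun t =>
    integral_comp_of_ae_mem_finset hg hV fun c => φ (p + t • c)
  have hL : ∫ x, g x ∂μ = ∑ c ∈ V, μ.real (g ⁻¹' {c}) • c :=
    integral_comp_of_ae_mem_finset hg hV id
  simp_rw [h, hL, map_sum, map_smul]
  refine HasDerivAt.fun_sum fun c _ => HasDerivAt.fun_const_smul _ ?_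
  have h1 : HasDerivAt (fun t : ℝ => p + t • c) c 0 := by
    simpa using ((hasDerivAt_id (0 : ℝ)).smul_const c).const_add p
  have h2 : HasFDerivAt φ L (p + (0 : ℝ) • c) := by simpa using hφ
  exact h2.comp_hasDerivAt 0 h1

/-- Reduction to scalar components: by Rademacher's theorem the line derivatives of the components
are those of the total derivative almost everywhere. -/
lemma integral_fderiv_apply {u : R3 → R3} {C : NNReal} (hu : LipschitzWith C u) (μ : Measure R3)
    (hμ : μ ≪ volume) (h : R3) (H : ∀ i, ∫ x, lineDeriv ℝ (fun z => u z i) x h ∂μ = 0) :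
    ∫ x, fderiv ℝ u x h ∂μ = 0 := by
  by_cases hint : Integrable (fun x => fderiv ℝ u x h) μ
  · funext i
    have e := (ContinuousLinearMap.proj (R := ℝ)
      (φ := fun _ : Fin 3 => ℝ) i).integral_comp_comm hint
    rw [ContinuousLinearMap.proj_apply] at e
    rw [← e, Pi.zero_apply, ← H i]
    refine integral_congr_ae ?_
    filter_upwards [hμ.ae_le (hu.ae_differentiableAt (μ := volume))] with x hx
    have hd := hasFDerivAt_pi'.1 hx.hasFDerivAt i
    rw [hd.differentiableAt.lineDeriv_eq_fderiv, hd.fderiv]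
    rfl
  -- A non-integrable function has integral zero by convention.
  · exact integral_undef hint

lemma lipschitzWith_apply {u : R3 → R3} {C : NNReal} (hu : LipschitzWith C u) (i : Fin 3) :
    LipschitzWith C fun z => u z i := by
  have := (LipschitzWith.eval (α := fun _ : Fin 3 => ℝ) i).comp hu
  rwa [one_mul] at this

lemma integral_fderiv_of_hasCompactSupport {u : R3 → R3} {C : NNReal} (hu : LipschitzWith C u)
    (hc : HasCompactSupport u) (h : R3) : ∫ x, fderiv ℝ u x h = 0 := by
  refine integral_fderiv_apply hu _ Measure.AbsolutelyContinuous.rfl h fun i => ?_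
  have hci : HasCompactSupport fun z => u z i := hc.comp_left (g := fun a : R3 => a i) rfl
  -- Integration by parts against the constant 1. The direction is `-h` because the formula reverses
  -- it when it moves the derivative to the other factor.
  have e := LipschitzWith.integral_lineDeriv_mul_eq (μ := volume) (LipschitzWith.const (1 : ℝ))
    (lipschitzWith_apply hu i) hci (-h)
  have h0 : ∀ x : R3, lineDeriv ℝ (fun _ : R3 => (1 : ℝ)) x (-h) = 0 := fun x => by
    simp [lineDeriv]
  simp only [h0, neg_neg, zero_mul, mul_one, integral_zero] at e
  exact e.symm

-- Both boxes are fundamental domains of the lattice generated by the vectors `L i` along the axes,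
-- and `f` is invariant under that lattice.
open scoped Pointwise in
lemma setIntegral_box_eq (L : Fin 3 → ℝ) (hL : ∀ i, 0 < L i) {f : R3 → ℝ}
    (hf : ∀ x i, f (x + Pi.single i (L i)) = f x) (c c' : R3) :
    ∫ x in (univ.pi fun i => Ico (c i) (c i + L i)), f x =
      ∫ x in (univ.pi fun i => Ico (c' i) (c' i + L i)), f x := by
  let b : Module.Basis (Fin 3) ℝ R3 :=
    (Pi.basisFun ℝ (Fin 3)).isUnitSMul (w := L) fun i => (hL i).ne'.isUnit
  have hbox : ∀ a : R3, (univ.pi fun i => Ico (a i) (a i + L i)) =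
      a +ᵥ ZSpan.fundamentalDomain b := by
    intro a
    ext x
    rw [mem_vadd_set_iff_neg_vadd_mem, ZSpan.mem_fundamentalDomain, mem_univ_pi]
    refine forall_congr' fun i => ?_
    have : b.repr (-a +ᵥ x) i = (x i - a i) / L i := by
      rw [Module.Basis.repr_isUnitSMul]
      simp [Units.smul_def]
      ring
    rw [this, mem_Ico, mem_Ico, le_div_iff₀ (hL i), div_lt_iff₀ (hL i)]
    constructor <;> rintro ⟨h1, h2⟩ <;> constructor <;> linarith
  have hfd : ∀ a : R3, IsAddFundamentalDomain (Submodule.span ℤ (range b)).toAddSubgroup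
      (a +ᵥ ZSpan.fundamentalDomain b) volume := fun a =>
    (ZSpan.isAddFundamentalDomain' b volume).vadd_of_comm a
  have : Countable (Submodule.span ℤ (range b)).toAddSubgroup :=
    inferInstanceAs (Countable (Submodule.span ℤ (range b)))
  rw [hbox, hbox]
  refine (hfd c).setIntegral_eq (hfd c') ?_
  rintro ⟨g, hg⟩
  change ∀ x, f (g + x) = f x
  replace hg : g ∈ Submodule.span ℤ (range b) := hg
  induction hg using Submodule.span_induction with
  | mem g hg =>
    obtain ⟨i, rfl⟩ := hg
    intro x
    have : b i = Pi.single i (L i) := by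
      rw [Module.Basis.isUnitSMul_apply]
      simp [← Pi.single_smul']
    rw [this, add_comm, hf]
  | zero => simp
  | add g g' _ _ h h' => intro x; rw [add_assoc, h, h']
  | smul n g _ h =>
    intro x
    have hn : ∀ (m : ℕ) x, f ((m : ℤ) • g + x) = f x := by
      intro m
      induction m with
      | zero => simp
      | succ m ih => intro x; push_cast; rw [add_smul, one_smul, add_assoc, ih, h]
    obtain ⟨m, rfl | rfl⟩ := n.eq_nat_or_neg
    · exact hn m x
    · rw [← hn m (-(m : ℤ) • g + x)]; simp

/-- The mean value of a directional derivative of a periodic function is zero. -/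
lemma setIntegral_fderiv_of_periodic (L : Fin 3 → ℝ) (hL : ∀ i, 0 < L i) {u : R3 → R3}
    {C : NNReal} (hu : LipschitzWith C u)
    (hp : ∀ x i, u (x + Pi.single i (L i)) = u x) (c h : R3) :
    ∫ x in Icc c (c + L), fderiv ℝ u x h = 0 := by
  have hae : (univ.pi fun i => Ico (c i) (c i + L i) : Set R3) =ᵐ[volume] Icc c (c + L) := by
    rw [← pi_univ_Icc]
    exact Measure.pi_Ico_ae_eq_pi_Icc
  rw [← setIntegral_congr_set hae]
  set D : Set R3 := univ.pi fun i => Ico (c i) (c i + L i) with hD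
  have hDm : MeasurableSet D := MeasurableSet.univ_pi fun i => measurableSet_Ico
  have hDf : volume D ≠ ⊤ := by
    rw [measure_congr hae]
    exact isCompact_Icc.measure_lt_top.ne
  refine integral_fderiv_apply hu _ Measure.restrict_le_self.absolutelyContinuous h fun i => ?_
  set f : R3 → ℝ := fun z => u z i with hf
  have hfl : LipschitzWith C f := lipschitzWith_apply hu i
  have hg : Integrable (D.indicator fun _ => (1 : ℝ)) :=
    (integrableOn_const hDf).integrable_indicator hDm
  -- The integral of the line derivative over the box is the limit of integrals of difference
  -- quotients. Each of these is zero, because translating a periodic function does not change its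
  -- integral over a period.
  have ht := LipschitzWith.integral_inv_smul_sub_mul_tendsto_integral_lineDeriv_mul hfl hg h
  have hI : ∀ a : R3, IntegrableOn (fun x => f (x + a)) D := fun a =>
    (((hfl.continuous.comp (continuous_add_const a)).continuousOn.integrableOn_compact
      (isCompact_Icc (a := c) (b := c + L)))).congr_set_ae hae
  have hI0 : IntegrableOn f D := by
    have := hI 0
    simp only [add_zero] at this
    exact this
  have hmul : ∀ F : R3 → ℝ, ∫ x, F x * D.indicator (fun _ => (1 : ℝ)) x = ∫ x in D, F x := by
    intro F
    rw [← integral_indicator hDm]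
    refine integral_congr_ae (Eventually.of_forall fun x => ?_)
    by_cases hx : x ∈ D <;> simp [hx]
  have htrans : ∀ a : R3, ∫ x in D, f (x + a) = ∫ x in D, f x := by
    intro a
    have hmp : MeasurePreserving (fun x : R3 => x + a) volume volume :=
      measurePreserving_add_right volume a
    have e := hmp.setIntegral_preimage_emb (measurableEmbedding_addRight a) f
      (univ.pi fun i => Ico ((c + a) i) ((c + a) i + L i))
    have hpre : (fun x : R3 => x + a) ⁻¹'
        (univ.pi fun i => Ico ((c + a) i) ((c + a) i + L i)) = D := by
      ext x
      simp only [hD, mem_preimage, mem_univ_pi, mem_Ico, Pi.add_apply]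
      refine forall_congr' fun i => ?_
      constructor <;> rintro ⟨h1, h2⟩ <;> constructor <;> linarith
    rw [hpre] at e
    rw [e]
    exact setIntegral_box_eq L hL (fun x j => congrFun (hp x j) i) _ _
  have hz : ∀ t : ℝ, ∫ x, t⁻¹ • (f (x + t • h) - f x) * D.indicator (fun _ => (1 : ℝ)) x = 0 := by
    intro t
    rw [hmul, integral_smul, integral_sub (hI _) hI0, htrans, sub_self, smul_zero]
  simp only [hz, hmul] at ht
  exact (tendsto_nhds_unique ht tendsto_const_nhds)

/-! ### The atomistic region, the A-CB region and the interface. -/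

variable {M : Fin 3 → ℕ} {R : Finset Lat} {Sa : Set (Finset Lat)}

/-- Off the closure of `interior P`, the open set `interior (P ∪ Q)` must lie in `Q`: the part
outside the closed set `Q` is open and contained in `P`. -/
lemma interior_union_subset_closure_interior {X : Type*} [TopologicalSpace X] {P Q : Set X}
    (hQ : IsClosed Q) :
    interior (P ∪ Q) ⊆ closure (interior P) ∪ closure (interior Q) := by
  intro x hx
  by_contra hc
  rw [mem_union, not_or] at hc
  have hO : IsOpen (interior (P ∪ Q) ∩ (closure (interior P))ᶜ) :=
    isOpen_interior.inter isClosed_closure.isOpen_compl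
  have hsub : interior (P ∪ Q) ∩ (closure (interior P))ᶜ ⊆ Q := by
    intro z hz
    by_contra hzQ
    refine hz.2 (subset_closure (mem_interior.2 ⟨_, ?_, hO.inter hQ.isOpen_compl, hz, hzQ⟩))
    rintro a ⟨ha, haQ⟩
    exact (interior_subset ha.1).resolve_right haQ
  exact hc.2 (subset_closure (mem_interior.2 ⟨_, hsub, hO, hx, hc.1⟩))

lemma isOpen_region (S : Set (Finset Lat)) : IsOpen (region k S) := isOpen_interior

lemma region_eq_interior (hk : 0 < k) {S : Set (Finset Lat)} (hS : S ⊆ cellTets) :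
    region k S = interior (⋃ T ∈ S, tet k T) := by
  rw [region, (isClosed_biUnion_cellTets hk hS).closure_eq]

lemma interior_closure_region_subset (S : Set (Finset Lat)) :
    interior (closure (region k S)) ⊆ region k S := by
  refine interior_mono ?_
  exact closure_minimal interior_subset isClosed_closure

lemma isCompact_domain (M : Fin 3 → ℕ) : IsCompact (domain M) := isCompact_Icc

lemma region_subset_domain {S : Set (Finset Lat)} (hS : S ⊆ domainTets k M) :
    region k S ⊆ domain M :=
  interior_subset.trans (closure_minimal (iUnion₂_subset fun _ hT => (hS hT).2)
    (isCompact_domain M).isClosed)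

/-- The tetrahedra of the lattice cells fill the periodic domain. -/
lemma exists_mem_domainTets (hk : 0 < k) {x : R3} (hx : x ∈ interior (domain M)) :
    ∃ T ∈ domainTets k M, x ∈ tet k T := by
  have hk' : (0 : ℝ) < k := by positivity
  obtain ⟨T, hT, hxT⟩ := exists_mem_typeA hk one_apply_ne_zero (mem_closure_cell hk x)
  refine ⟨T, ⟨⟨_, hT⟩, tet_subset (convex_Icc _ _) fun p hp => ?_⟩, hxT⟩
  have hp' := (mem_closure_bondVolume_iff hk one_apply_ne_zero).1
    (tet_subset_of_mem_typeA hk one_apply_ne_zero hT (pos_mem_tet hp))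
  have hlt : ∀ i, x i ∈ Ioo (-(M i : ℝ) + 1) (M i) := by
    intro i
    have h : x ∈ interior (univ.pi fun i => Icc (-(M i : ℝ) + 1) (M i)) := by
      rwa [pi_univ_Icc]
    rw [interior_pi_set finite_univ] at h
    simpa using h i (mem_univ i)
  -- The faces of `Ω` are lattice planes, so the cell of an interior point cannot cross them.
  have key : ∀ i, (k : ℤ) * (-(M i : ℤ) + 1) ≤ p i ∧ p i ≤ (k : ℤ) * (M i : ℤ) := by
    intro i
    have h1 := hp' i
    rw [relCoord_pos hk] at h1
    simp only [Pi.one_apply, Int.cast_one, div_one, mem_Icc] at h1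
    have h4 : ⌊(k : ℝ) * x i⌋ ≤ p i := by exact_mod_cast sub_nonneg.1 h1.1
    have h5 : p i ≤ ⌊(k : ℝ) * x i⌋ + 1 := by
      have := h1.2
      rw [sub_le_iff_le_add'] at this
      exact_mod_cast this
    constructor
    · refine le_trans (Int.le_floor.2 ?_) h4
      push_cast
      exact mul_le_mul_of_nonneg_left (hlt i).1.le hk'.le
    · refine h5.trans (Int.add_one_le_of_lt (Int.floor_lt.2 ?_))
      push_cast
      exact mul_lt_mul_of_pos_left (hlt i).2 hk'
  constructor <;> intro i <;> simp only [pos]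
  · rw [le_div_iff₀' hk']
    exact_mod_cast (key i).1
  · rw [div_le_iff₀' hk']
    exact_mod_cast (key i).2

lemma mem_latticePeriod_of_pos_mem (hk : 0 < k) {ℓ : Lat} (h : pos k ℓ ∈ domain M) :
    ℓ ∈ latticePeriod k M := by
  have hk' : (0 : ℝ) < k := by positivity
  rw [latticePeriod, Finset.mem_Icc]
  constructor <;> intro i
  · have := h.1 i
    simp only [pos] at this
    rw [le_div_iff₀' hk'] at this
    exact_mod_cast this
  · have := h.2 i
    simp only [pos] at this
    rw [div_le_iff₀' hk'] at this
    exact_mod_cast this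

lemma interior_domain_subset (hk : 0 < k) (hSa : Sa ⊆ domainTets k M) :
    interior (domain M) ⊆ closure (region k Sa) ∪ closure (acbRegion k M Sa) := by
  have h1 : Sa ⊆ cellTets := fun T hT => (hSa hT).1
  have h2 : domainTets k M \ Sa ⊆ cellTets := fun T hT => hT.1.1
  rw [acbRegion, region_eq_interior hk h1, region_eq_interior hk h2]
  refine Subset.trans ?_ (interior_union_subset_closure_interior (isClosed_biUnion_cellTets hk h2))
  refine interior_maximal (fun x hx => ?_) isOpen_interior
  obtain ⟨T, hT, hxT⟩ := exists_mem_domainTets hk hx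
  by_cases h : T ∈ Sa
  · exact Or.inl (mem_iUnion₂.2 ⟨T, h, hxT⟩)
  · exact Or.inr (mem_iUnion₂.2 ⟨T, ⟨hT, h⟩, hxT⟩)

/-- The intersection is open and covered by countably many overlaps of distinct cell tetrahedra,
which are null; an open null set is empty. -/
lemma disjoint_regions (hk : 0 < k) (hSa : Sa ⊆ domainTets k M) :
    Disjoint (region k Sa) (acbRegion k M Sa) := by
  have h1 : Sa ⊆ cellTets := fun T hT => (hSa hT).1
  have h2 : domainTets k M \ Sa ⊆ cellTets := fun T hT => hT.1.1
  rw [acbRegion, disjoint_iff_inter_eq_empty,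
    ← ((isOpen_region Sa).inter (isOpen_region _)).measure_eq_zero_iff (volume : Measure R3)]
  rw [region_eq_interior hk h1, region_eq_interior hk h2]
  refine measure_mono_null (inter_subset_inter interior_subset interior_subset) ?_
  simp only [iUnion_inter, inter_iUnion]
  rw [measure_biUnion_null_iff (to_countable _)]
  intro T' hT'
  rw [measure_biUnion_null_iff (to_countable _)]
  intro T hT
  exact ((isMesh_cellTets hk).agree T (h1 hT) T' (h2 hT')).volume_inter hk
    ((isMesh_cellTets hk).interpolable T (h1 hT)) ((isMesh_cellTets hk).interpolable T' (h2 hT'))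
    (by rintro rfl; exact hT'.2 hT)

lemma disjoint_region_closure_acb (hk : 0 < k) (hSa : Sa ⊆ domainTets k M) :
    Disjoint (region k Sa) (closure (acbRegion k M Sa)) :=
  (disjoint_regions hk hSa).closure_right (isOpen_region _)

lemma disjoint_closure_region_acb (hk : 0 < k) (hSa : Sa ⊆ domainTets k M) :
    Disjoint (closure (region k Sa)) (acbRegion k M Sa) :=
  (disjoint_regions hk hSa).closure_left (isOpen_region _)

lemma ae_mem_region_or_acb (hk : 0 < k) (M : Fin 3 → ℕ) (Sa : Set (Finset Lat)) :
    ∀ᵐ x : R3, x ∈ domain M → x ∈ region k Sa ∨ x ∈ acbRegion k M Sa := by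
  have hfr := measure_eq_zero_iff_ae_notMem.1
    ((convex_Icc (fun i => -(M i : ℝ) + 1) (fun i => (M i : ℝ))).addHaar_frontier volume)
  filter_upwards [hfr, ae_mem_interior_tet k] with x hx hint hxM
  have hxi : x ∈ interior (domain M) := by
    by_contra hc
    exact hx ⟨subset_closure hxM, hc⟩
  obtain ⟨T, hT, hxT⟩ := exists_mem_domainTets hk hxi
  have hsub : ∀ S : Set (Finset Lat), T ∈ S → x ∈ region k S := fun S hTS =>
    interior_mono ((subset_biUnion_of_mem (u := fun T => tet k T) hTS).trans subset_closure)
      (hint T hxT)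
  by_cases h : T ∈ Sa
  · exact Or.inl (hsub _ h)
  · exact Or.inr (hsub _ ⟨hT, h⟩)

lemma isOpen_bondVolume (ℓ η : Lat) : IsOpen (bondVolume k ℓ η) :=
  isOpen_set_pi finite_univ fun _ _ => isOpen_Ioo

lemma isPreconnected_bondVolume (ℓ η : Lat) : IsPreconnected (bondVolume k ℓ η) :=
  (convex_pi fun _ _ => convex_Ioo _ _ : Convex ℝ (bondVolume k ℓ η)).isPreconnected

/-- A box that misses `Γ` is connected and covered by the two closed regions, hence lies in the
closure of `Ω_a`, and even in `Ω_a`, which is the interior of its closure. If its closure also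
misses `Γ`, then so does the closure lie in `Ω_a`. -/
lemma isAtomistic_or_isInterfacial (hk : 0 < k) (hSa : IsSplitting k M R Sa) {η ℓ : Lat}
    (hη : η ∈ R) (h : (bondVolume k ℓ η ∩ region k Sa).Nonempty) :
    IsAtomistic k Sa η ℓ ∨ IsInterfacial k M Sa η ℓ := by
  have hfar : closure (bondVolume k ℓ η) ⊆ interior (domain M) :=
    hSa.far η hη ℓ (h.mono (inter_subset_inter subset_closure subset_closure))
  have hcov := hfar.trans (interior_domain_subset hk hSa.subset)
  by_cases h1 : (bondVolume k ℓ η ∩ interface k M Sa).Nonempty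
  · exact Or.inr (Or.inl h1)
  have hB : bondVolume k ℓ η ⊆ closure (region k Sa) := by
    rcases isPreconnected_iff_subset_of_disjoint_closed.1 (isPreconnected_bondVolume ℓ η) _ _
      isClosed_closure isClosed_closure (subset_closure.trans hcov)
      (not_nonempty_iff_eq_empty.1 h1) with h2 | h2
    · exact h2
    · obtain ⟨x, hxB, hx⟩ := h
      exact (h1 ⟨x, hxB, subset_closure hx, h2 hxB⟩).elim
  have hB' : bondVolume k ℓ η ⊆ region k Sa :=
    (interior_maximal hB (isOpen_bondVolume ℓ η)).trans (interior_closure_region_subset Sa)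
  by_cases h3 : (closure (bondVolume k ℓ η) ∩ interface k M Sa).Nonempty
  · exact Or.inr (Or.inr ⟨hB', h3⟩)
  left
  have hcl : closure (bondVolume k ℓ η) ⊆ closure (region k Sa) :=
    closure_minimal hB isClosed_closure
  have hO : interior (domain M) ∩ (closure (acbRegion k M Sa))ᶜ ⊆ closure (region k Sa) := by
    rintro x ⟨hx, hx'⟩
    exact (interior_domain_subset hk hSa.subset hx).resolve_right hx'
  refine Subset.trans ?_ (interior_closure_region_subset Sa)
  refine Subset.trans ?_ (interior_maximal hO (isOpen_interior.inter isClosed_closure.isOpen_compl))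
  exact fun x hx => ⟨hfar hx, fun hx' => h3 ⟨x, hx, hcl hx, hx'⟩⟩

lemma IsInterfacial.closure_inter {η ℓ : Lat} (h : IsInterfacial k M Sa η ℓ) :
    (closure (bondVolume k ℓ η) ∩ interface k M Sa).Nonempty := by
  rcases h with h | h
  · exact h.mono (inter_subset_inter_left _ subset_closure)
  · exact h.2

lemma IsAtomistic.not_isInterfacial (hk : 0 < k) (hSa : Sa ⊆ domainTets k M) {η ℓ : Lat}
    (h : IsAtomistic k Sa η ℓ) : ¬ IsInterfacial k M Sa η ℓ := by
  intro h'
  obtain ⟨x, hx, -, hx'⟩ := h'.closure_inter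
  exact disjoint_left.1 (disjoint_region_closure_acb hk hSa) (h hx) hx'

lemma pos_mem_closure_bondVolume (hk : 0 < k) {ℓ η : Lat} (hη : ∀ i, η i ≠ 0) :
    pos k ℓ ∈ closure (bondVolume k ℓ η) := by
  rw [closure_bondVolume hk hη]
  exact fun i _ => left_mem_uIcc

/-- Thus the restriction of the sums to `𝔏` drops no bond volume that matters. -/
lemma mem_latticePeriod_of_isAtomistic_or_isInterfacial (hk : 0 < k) (hSa : IsSplitting k M R Sa)
    {η ℓ : Lat} (hηR : η ∈ R) (hη : ∀ i, η i ≠ 0)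
    (h : IsAtomistic k Sa η ℓ ∨ IsInterfacial k M Sa η ℓ) : ℓ ∈ latticePeriod k M := by
  refine mem_latticePeriod_of_pos_mem hk (interior_subset
    (hSa.far η hηR ℓ ?_ (pos_mem_closure_bondVolume hk hη)))
  rcases h with h | h
  · exact ⟨_, pos_mem_closure_bondVolume hk hη,
      subset_closure (h (pos_mem_closure_bondVolume hk hη))⟩
  · obtain ⟨x, hx, hx', -⟩ := h.closure_inter
    exact ⟨x, hx, hx'⟩

/-! ### Decompositions of bond volumes and their compatibility. -/

variable {η : Lat} {𝒟 : Lat → Finset (Finset Lat)}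

lemma IsEqOrAdjacent.symm {ℓ ℓ' : Lat} (h : IsEqOrAdjacent η ℓ ℓ') : IsEqOrAdjacent η ℓ' ℓ := by
  rcases h with rfl | ⟨i, rfl | rfl⟩
  · exact Or.inl rfl
  · exact Or.inr ⟨i, Or.inr (by simp)⟩
  · exact Or.inr ⟨i, Or.inl (by simp)⟩

lemma IsEqOrAdjacent.dvd {ℓ ℓ' : Lat} (h : IsEqOrAdjacent η ℓ ℓ') (j : Fin 3) :
    η j ∣ ℓ' j - ℓ j := by
  rcases h with rfl | ⟨i, rfl | rfl⟩
  · simp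
  all_goals
    rcases eq_or_ne j i with rfl | hj
    · simp
    · simp [hj]

lemma bondTets_of_isInterfacial (hk : 0 < k) (hSa : Sa ⊆ domainTets k M) {ℓ : Lat}
    (h : IsInterfacial k M Sa η ℓ) : bondTets k M Sa η 𝒟 ℓ = (𝒟 ℓ : Set (Finset Lat)) := by
  rw [bondTets, if_neg fun h' => h'.not_isInterfacial hk hSa h, if_pos h]

lemma bondTets_of_isAtomistic {ℓ : Lat} (h : IsAtomistic k Sa η ℓ) :
    bondTets k M Sa η 𝒟 ℓ = (typeA ℓ η : Set (Finset Lat)) := if_pos h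

lemma bondTets_of_not {ℓ : Lat} (h : ¬ (IsAtomistic k Sa η ℓ ∨ IsInterfacial k M Sa η ℓ)) :
    bondTets k M Sa η 𝒟 ℓ = {T | T ∈ cellTets ∧ tet k T ⊆ closure (bondVolume k ℓ η)} := by
  rw [not_or] at h
  rw [bondTets, if_neg h.1, if_neg h.2]

lemma exists_mem_bondTets (hk : 0 < k) (hη : ∀ i, η i ≠ 0) (hSa : Sa ⊆ domainTets k M)
    (h𝒟 : IsAdmissible k M Sa η 𝒟) {ℓ : Lat} {x : R3} (hx : x ∈ closure (bondVolume k ℓ η)) :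
    ∃ T ∈ bondTets k M Sa η 𝒟 ℓ, x ∈ tet k T := by
  by_cases h : IsAtomistic k Sa η ℓ ∨ IsInterfacial k M Sa η ℓ
  · rcases h with h | h
    · rw [bondTets_of_isAtomistic h]
      exact exists_mem_typeA hk hη hx
    · rw [bondTets_of_isInterfacial hk hSa h]
      rw [← h𝒟.cover ℓ h] at hx
      simpa using hx
  · rw [bondTets_of_not h]
    obtain ⟨T, hT, hs, hxT⟩ := exists_mem_cellTets_subset hk hη hx
    exact ⟨T, ⟨hT, hs⟩, hxT⟩

lemma tet_subset_of_mem_bondTets (hk : 0 < k) (hη : ∀ i, η i ≠ 0) (hSa : Sa ⊆ domainTets k M)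
    (h𝒟 : IsAdmissible k M Sa η 𝒟) {ℓ : Lat} {T : Finset Lat} (hT : T ∈ bondTets k M Sa η 𝒟 ℓ) :
    tet k T ⊆ closure (bondVolume k ℓ η) := by
  by_cases h : IsAtomistic k Sa η ℓ ∨ IsInterfacial k M Sa η ℓ
  · rcases h with h | h
    · rw [bondTets_of_isAtomistic h] at hT
      exact tet_subset_of_mem_typeA hk hη hT
    · rw [bondTets_of_isInterfacial hk hSa h] at hT
      rw [← h𝒟.cover ℓ h]
      exact subset_biUnion_of_mem (u := fun T => tet k T) hT
  · rw [bondTets_of_not h] at hT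
    exact hT.2

lemma interpolable_of_mem_bondTets (hk : 0 < k) (hη : ∀ i, η i ≠ 0) (hSa : Sa ⊆ domainTets k M)
    (h𝒟 : IsAdmissible k M Sa η 𝒟) {ℓ : Lat} {T : Finset Lat} (hT : T ∈ bondTets k M Sa η 𝒟 ℓ) :
    Interpolable k T := by
  by_cases h : IsAtomistic k Sa η ℓ ∨ IsInterfacial k M Sa η ℓ
  · rcases h with h | h
    · rw [bondTets_of_isAtomistic h] at hT
      exact interpolable_of_mem_typeA hk hη hT
    · rw [bondTets_of_isInterfacial hk hSa h] at hT
      obtain ⟨hc, ha⟩ := h𝒟.nondegenerate ℓ h T hT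
      exact interpolable_of_affineIndependent hc ha
  · rw [bondTets_of_not h] at hT
    exact (isMesh_cellTets hk).interpolable T hT.1

/-- This is what makes every glued interpolant coincide with the cell interpolant away from the
atomistic region. -/
lemma subordinate_of_mem_bondTets (hk : 0 < k) (hη : ∀ i, η i ≠ 0) (hSa : Sa ⊆ domainTets k M)
    (h𝒟 : IsAdmissible k M Sa η 𝒟) {ℓ : Lat} {T : Finset Lat} (hT : T ∈ bondTets k M Sa η 𝒟 ℓ) :
    tet k T ⊆ closure (region k Sa) ∨ T ∈ cellTets := by
  by_cases h : IsAtomistic k Sa η ℓ ∨ IsInterfacial k M Sa η ℓ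
  · rcases h with h | h
    · exact Or.inl ((tet_subset_of_mem_bondTets hk hη hSa h𝒟 hT).trans (h.trans subset_closure))
    · rw [bondTets_of_isInterfacial hk hSa h] at hT
      exact (h𝒟.subordinate ℓ h T hT).imp_right And.left
  · rw [bondTets_of_not h] at hT
    exact Or.inr hT.1

lemma agree_of_isInterfacial (hk : 0 < k) (hη : ∀ i, η i ≠ 0) (hSa : Sa ⊆ domainTets k M)
    (h𝒟 : IsAdmissible k M Sa η 𝒟) {ℓ ℓ' : Lat} (hℓ : IsInterfacial k M Sa η ℓ)
    (hadj : IsEqOrAdjacent η ℓ ℓ') {T T' : Finset Lat} (hT : T ∈ bondTets k M Sa η 𝒟 ℓ)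
    (hT' : T' ∈ bondTets k M Sa η 𝒟 ℓ') : Agree k T T' := by
  classical
  have hmem := hT
  rw [bondTets_of_isInterfacial hk hSa hℓ] at hmem
  refine Agree.of_inter hk (interpolable_of_mem_bondTets hk hη hSa h𝒟 hT)
    (interpolable_of_mem_bondTets hk hη hSa h𝒟 hT') ?_
  convert h𝒟.conforming ℓ hℓ ℓ' hadj T hmem T' hT'

lemma nonempty_inter_region_of_mem_closure {ℓ : Lat} {x : R3}
    (hx : x ∈ closure (bondVolume k ℓ η)) (hxa : x ∈ region k Sa) :
    (bondVolume k ℓ η ∩ region k Sa).Nonempty := by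
  rw [inter_comm]
  exact mem_closure_iff.1 hx _ (isOpen_region Sa) hxa

/-- The decompositions of bond volumes that share a face are compatible. -/
lemma agree_of_isEqOrAdjacent (hk : 0 < k) (hη : ∀ i, η i ≠ 0) (hSa : IsSplitting k M R Sa)
    (hηR : η ∈ R) (h𝒟 : IsAdmissible k M Sa η 𝒟) {ℓ ℓ' : Lat} (hadj : IsEqOrAdjacent η ℓ ℓ')
    {T T' : Finset Lat} (hT : T ∈ bondTets k M Sa η 𝒟 ℓ) (hT' : T' ∈ bondTets k M Sa η 𝒟 ℓ') :
    Agree k T T' := by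
  by_cases hi : IsInterfacial k M Sa η ℓ
  · exact agree_of_isInterfacial hk hη hSa.subset h𝒟 hi hadj hT hT'
  by_cases hi' : IsInterfacial k M Sa η ℓ'
  · exact (agree_of_isInterfacial hk hη hSa.subset h𝒟 hi' hadj.symm hT' hT).symm
  -- The mixed case is vacuous: a common point lies in the open set `Ω_a`, so the second bond volume
  -- meets `Ω_a` and is atomistic or interfacial.
  have hmix : ∀ {ℓ ℓ' : Lat} {T T' : Finset Lat}, IsAtomistic k Sa η ℓ →
      ¬ IsAtomistic k Sa η ℓ' → ¬ IsInterfacial k M Sa η ℓ' → T ∈ bondTets k M Sa η 𝒟 ℓ →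
      T' ∈ bondTets k M Sa η 𝒟 ℓ' → Agree k T T' := by
    intro ℓ ℓ' T T' ha ha' hi' hT hT' x w w' hw hw'
    have hx := ha (tet_subset_of_mem_bondTets hk hη hSa.subset h𝒟 hT ((mem_tet_iff hk).2 ⟨w, hw⟩))
    have hx' := tet_subset_of_mem_bondTets hk hη hSa.subset h𝒟 hT' ((mem_tet_iff hk).2 ⟨w', hw'⟩)
    exact ((isAtomistic_or_isInterfacial hk hSa hηR
      (nonempty_inter_region_of_mem_closure hx' hx)).elim ha' hi').elim
  by_cases ha : IsAtomistic k Sa η ℓ <;> by_cases ha' : IsAtomistic k Sa η ℓ'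
  · rw [bondTets_of_isAtomistic ha] at hT
    rw [bondTets_of_isAtomistic ha'] at hT'
    exact agree_of_mem_typeA hk hη hadj.dvd hT hT'
  · exact hmix ha ha' hi' hT hT'
  · exact (hmix ha' ha hi hT' hT).symm
  · rw [bondTets_of_not (not_or.2 ⟨ha, hi⟩)] at hT
    rw [bondTets_of_not (not_or.2 ⟨ha', hi'⟩)] at hT'
    exact (isMesh_cellTets hk).agree T hT.1 T' hT'.1

lemma isMesh_bondTets (hk : 0 < k) (hη : ∀ i, η i ≠ 0) (hSa : IsSplitting k M R Sa)
    (hηR : η ∈ R) (h𝒟 : IsAdmissible k M Sa η 𝒟) (ℓ : Lat) :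
    IsMesh k (bondTets k M Sa η 𝒟 ℓ) where
  interpolable := fun _ hT => interpolable_of_mem_bondTets hk hη hSa.subset h𝒟 hT
  agree := fun _ hT _ hT' => agree_of_isEqOrAdjacent hk hη hSa hηR h𝒟 (Or.inl rfl) hT hT'

lemma interp_bondTets_eq_of_adjacent (hk : 0 < k) (hη : ∀ i, η i ≠ 0) (hSa : IsSplitting k M R Sa)
    (hηR : η ∈ R) (h𝒟 : IsAdmissible k M Sa η 𝒟) {ℓ ℓ' : Lat} (hadj : IsEqOrAdjacent η ℓ ℓ')
    {x : R3} (hx : x ∈ closure (bondVolume k ℓ η)) (hx' : x ∈ closure (bondVolume k ℓ' η))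
    (y : Lat → R3) :
    interp k (bondTets k M Sa η 𝒟 ℓ) y x = interp k (bondTets k M Sa η 𝒟 ℓ') y x := by
  obtain ⟨T, hT, hxT⟩ := exists_mem_bondTets hk hη hSa.subset h𝒟 hx
  obtain ⟨T', hT', hxT'⟩ := exists_mem_bondTets hk hη hSa.subset h𝒟 hx'
  obtain ⟨w, hw⟩ := (mem_tet_iff hk).1 hxT
  obtain ⟨w', hw'⟩ := (mem_tet_iff hk).1 hxT'
  rw [(isMesh_bondTets hk hη hSa hηR h𝒟 ℓ).interp_eq hT hw,
    (isMesh_bondTets hk hη hSa hηR h𝒟 ℓ').interp_eq hT' hw']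
  exact agree_of_isEqOrAdjacent hk hη hSa hηR h𝒟 hadj hT hT' x w w' hw hw' y

/-- Two bond volumes of the same partition of space whose closures meet are connected by a chain
of bond volumes that share faces. -/
lemma interp_bondTets_eq (hk : 0 < k) (hη : ∀ i, η i ≠ 0) (hSa : IsSplitting k M R Sa)
    (hηR : η ∈ R) (h𝒟 : IsAdmissible k M Sa η 𝒟) {ℓ ℓ' : Lat} (hℓ : ∀ i, η i ∣ ℓ' i - ℓ i)
    {x : R3} (hx : x ∈ closure (bondVolume k ℓ η)) (hx' : x ∈ closure (bondVolume k ℓ' η))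
    (y : Lat → R3) :
    interp k (bondTets k M Sa η 𝒟 ℓ) y x = interp k (bondTets k M Sa η 𝒟 ℓ') y x := by
  -- The chain replaces the coordinates of `ℓ` by those of `ℓ'` one at a time. Membership in a
  -- closed box is a condition on each coordinate, so `x` stays in all the boxes.
  let c : ℕ → Lat := fun j i => if i.val < j then ℓ' i else ℓ i
  have hc : ∀ j, x ∈ closure (bondVolume k (c j) η) := by
    intro j
    rw [mem_closure_bondVolume_iff hk hη] at hx hx' ⊢
    intro i
    simp only [relCoord, c]
    split_ifs
    · exact hx' i
    · exact hx i
  have hadj : ∀ j < 3, IsEqOrAdjacent η (c j) (c (j + 1)) := by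
    intro j hj
    obtain ⟨n, hn⟩ := hℓ ⟨j, hj⟩
    have hη' : (η ⟨j, hj⟩ : ℝ) ≠ 0 := by exact_mod_cast hη _
    rw [mem_closure_bondVolume_iff hk hη] at hx hx'
    have e : relCoord k ℓ η x ⟨j, hj⟩ = relCoord k ℓ' η x ⟨j, hj⟩ + n := by
      have hnr : ((ℓ' ⟨j, hj⟩ : ℝ) - ℓ ⟨j, hj⟩) = η ⟨j, hj⟩ * n := by exact_mod_cast hn
      simp only [relCoord]
      field_simp
      linarith
    have h1 := hx ⟨j, hj⟩
    have h2 := hx' ⟨j, hj⟩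
    -- Both relative coordinates lie in `[0, 1]` and differ by `n`, so each step stays put or
    -- crosses one face.
    have hn1 : n ≤ 1 := by
      have : (n : ℝ) ≤ 1 := by linarith [h1.2, h2.1]
      exact_mod_cast this
    have hn2 : -1 ≤ n := by
      have : (-1 : ℝ) ≤ n := by linarith [h1.1, h2.2]
      exact_mod_cast this
    have hstep : c (j + 1) = c j + Pi.single ⟨j, hj⟩ (η ⟨j, hj⟩ * n) := by
      funext i
      rw [Pi.add_apply, ← hn]
      rcases eq_or_ne i ⟨j, hj⟩ with rfl | hi
      · simp [c]
      · have : i.val ≠ j := fun h => hi (Fin.ext h)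
        simp only [c, Pi.single_eq_of_ne hi, add_zero]
        by_cases h : i.val < j
        · rw [if_pos h, if_pos (by omega)]
        · rw [if_neg h, if_neg (by omega)]
    have hcases : n = -1 ∨ n = 0 ∨ n = 1 := by omega
    rcases hcases with rfl | rfl | rfl
    · exact Or.inr ⟨_, Or.inr (by rw [hstep, mul_neg_one, Pi.single_neg, sub_eq_add_neg])⟩
    · exact Or.inl (by rw [hstep, mul_zero, Pi.single_zero, add_zero])
    · exact Or.inr ⟨_, Or.inl (by rw [hstep, mul_one])⟩
  have hstep := fun j (hj : j < 3) =>
    interp_bondTets_eq_of_adjacent hk hη hSa hηR h𝒟 (hadj j hj) (hc j) (hc (j + 1)) y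
  have h0 : c 0 = ℓ := by funext i; simp [c]
  have h3 : c 3 = ℓ' := by funext i; simp [c]
  rw [← h0, hstep 0 (by omega), hstep 1 (by omega), hstep 2 (by omega), h3]

/-! ### The glued interpolant on one partition. -/

/-- The tetrahedra of all bond volumes of one of the partitions of space into bond volumes. -/
def cosetTets (k : ℕ) (M : Fin 3 → ℕ) (Sa : Set (Finset Lat)) (η : Lat)
    (𝒟 : Lat → Finset (Finset Lat)) (r : Lat) : Set (Finset Lat) :=
  {T | ∃ ℓ : Lat, (∀ i, η i ∣ ℓ i - r i) ∧ T ∈ bondTets k M Sa η 𝒟 ℓ}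

lemma isMesh_cosetTets (hk : 0 < k) (hη : ∀ i, η i ≠ 0) (hSa : IsSplitting k M R Sa)
    (hηR : η ∈ R) (h𝒟 : IsAdmissible k M Sa η 𝒟) (r : Lat) :
    IsMesh k (cosetTets k M Sa η 𝒟 r) where
  interpolable := fun _ ⟨_, _, hT⟩ => interpolable_of_mem_bondTets hk hη hSa.subset h𝒟 hT
  agree := by
    rintro T ⟨ℓ, hℓ, hT⟩ T' ⟨ℓ', hℓ', hT'⟩ x w w' hw hw' y
    rw [← (isMesh_bondTets hk hη hSa hηR h𝒟 ℓ).interp_eq hT hw,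
      ← (isMesh_bondTets hk hη hSa hηR h𝒟 ℓ').interp_eq hT' hw']
    refine interp_bondTets_eq hk hη hSa hηR h𝒟 (fun i => ?_)
      (tet_subset_of_mem_bondTets hk hη hSa.subset h𝒟 hT ((mem_tet_iff hk).2 ⟨w, hw⟩))
      (tet_subset_of_mem_bondTets hk hη hSa.subset h𝒟 hT' ((mem_tet_iff hk).2 ⟨w', hw'⟩)) y
    have := dvd_sub (hℓ' i) (hℓ i)
    rwa [sub_sub_sub_cancel_right] at this

/-- The bond volume of the partition given by `r` in which a point lies. -/
def cosetIndex (k : ℕ) (η r : Lat) (x : R3) : Lat := fun i => r i + η i * ⌊relCoord k r η x i⌋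

lemma relCoord_cosetIndex (hη : ∀ i, η i ≠ 0) (r : Lat) (x : R3) (i : Fin 3) :
    relCoord k (cosetIndex k η r x) η x i = Int.fract (relCoord k r η x i) := by
  have hη' : (η i : ℝ) ≠ 0 := by exact_mod_cast hη i
  rw [← Int.self_sub_floor]
  rw [relCoord, cosetIndex]
  generalize ⌊relCoord k r η x i⌋ = n
  rw [relCoord]
  push_cast
  field_simp
  ring

lemma mem_closure_cosetIndex (hk : 0 < k) (hη : ∀ i, η i ≠ 0) (r : Lat) (x : R3) :
    x ∈ closure (bondVolume k (cosetIndex k η r x) η) := by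
  rw [mem_closure_bondVolume_iff hk hη]
  intro i
  rw [relCoord_cosetIndex hη]
  exact ⟨Int.fract_nonneg _, (Int.fract_lt_one _).le⟩

lemma dvd_cosetIndex_sub (r : Lat) (x : R3) (i : Fin 3) : η i ∣ cosetIndex k η r x i - r i :=
  ⟨_, by rw [cosetIndex, add_sub_cancel_left]⟩

lemma exists_mem_cosetTets (hk : 0 < k) (hη : ∀ i, η i ≠ 0) (hSa : Sa ⊆ domainTets k M)
    (h𝒟 : IsAdmissible k M Sa η 𝒟) (r : Lat) (x : R3) :
    ∃ T ∈ cosetTets k M Sa η 𝒟 r, x ∈ tet k T := by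
  obtain ⟨T, hT, hx⟩ := exists_mem_bondTets hk hη hSa h𝒟 (mem_closure_cosetIndex hk hη r x)
  exact ⟨T, ⟨_, dvd_cosetIndex_sub r x, hT⟩, hx⟩

lemma abs_sub_le_of_mem_cosetTets (hk : 0 < k) (hη : ∀ i, η i ≠ 0) (hSa : Sa ⊆ domainTets k M)
    (h𝒟 : IsAdmissible k M Sa η 𝒟) {r : Lat} {T : Finset Lat} (hT : T ∈ cosetTets k M Sa η 𝒟 r)
    {p q : Lat} (hp : p ∈ T) (hq : q ∈ T) (i : Fin 3) :
    |p i - q i| ≤ ((∑ j, (η j).natAbs : ℕ) : ℤ) := by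
  obtain ⟨ℓ, -, hT⟩ := hT
  have hs := tet_subset_of_mem_bondTets hk hη hSa h𝒟 hT
  refine (abs_sub_le_of_mem_closure_bondVolume hk hη (hs (pos_mem_tet hp)) (hs (pos_mem_tet hq))
    i).trans ?_
  rw [Int.abs_eq_natAbs]
  exact_mod_cast Finset.single_le_sum (f := fun j => (η j).natAbs) (fun _ _ => Nat.zero_le _)
    (Finset.mem_univ i)

open Classical in
/-- The indices of the bond volumes that belong to the atomistic region or to the interface. -/
def activeBonds (k : ℕ) (M : Fin 3 → ℕ) (Sa : Set (Finset Lat)) (η : Lat) : Finset Lat :=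
  {ℓ ∈ latticePeriod k M | IsAtomistic k Sa η ℓ ∨ IsInterfacial k M Sa η ℓ}

lemma mem_activeBonds_iff (hk : 0 < k) (hη : ∀ i, η i ≠ 0) (hSa : IsSplitting k M R Sa)
    (hηR : η ∈ R) {ℓ : Lat} : ℓ ∈ activeBonds k M Sa η ↔
      IsAtomistic k Sa η ℓ ∨ IsInterfacial k M Sa η ℓ := by
  classical
  rw [activeBonds, Finset.mem_filter, and_iff_right_iff_imp]
  exact mem_latticePeriod_of_isAtomistic_or_isInterfacial hk hSa hηR hη

lemma finite_bondTets (hk : 0 < k) (hSa : Sa ⊆ domainTets k M) {ℓ : Lat}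
    (h : IsAtomistic k Sa η ℓ ∨ IsInterfacial k M Sa η ℓ) : (bondTets k M Sa η 𝒟 ℓ).Finite := by
  rcases h with h | h
  · rw [bondTets_of_isAtomistic h]
    exact Finset.finite_toSet _
  · rw [bondTets_of_isInterfacial hk hSa h]
    exact Finset.finite_toSet _

/-- Only finitely many tetrahedra come from atomistic or interface bond volumes. All others are cell
tetrahedra, with the uniform constant `6 * k * C`. -/
lemma exists_lipschitzWith_interp_cosetTets (hk : 0 < k) (hη : ∀ i, η i ≠ 0)
    (hSa : IsSplitting k M R Sa) (hηR : η ∈ R) (h𝒟 : IsAdmissible k M Sa η 𝒟) {v : Lat → R3}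
    {C : NNReal} (hC : ∀ p, ‖v p‖ ≤ C) (r : Lat) :
    ∃ K, LipschitzWith K (interp k (cosetTets k M Sa η 𝒟 r) v) := by
  have hA : ∀ T, ∃ (A : R3 →ᵃ[ℝ] R3) (K : NNReal), Interpolable k T →
      (∀ p ∈ T, A (pos k p) = v p) ∧ LipschitzWith K A := by
    intro T
    by_cases hT : Interpolable k T
    · obtain ⟨A, hA⟩ := hT v
      obtain ⟨K, hK⟩ := exists_lipschitzWith_affineMap A
      exact ⟨A, K, fun _ => ⟨hA, hK⟩⟩
    · exact ⟨0, 0, fun h => (hT h).elim⟩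
  choose A K hAK using hA
  have hfin : (⋃ ℓ ∈ (activeBonds k M Sa η : Set Lat), bondTets k M Sa η 𝒟 ℓ).Finite :=
    (Finset.finite_toSet _).biUnion fun ℓ hℓ =>
      finite_bondTets hk hSa.subset ((mem_activeBonds_iff hk hη hSa hηR).1 hℓ)
  obtain ⟨K₁, hK₁⟩ := (hfin.image K).bddAbove
  refine ⟨max (6 * k * C) K₁, (isMesh_cosetTets hk hη hSa hηR h𝒟 r).lipschitzWith hk
    (fun T hT p hp q hq i => abs_sub_le_of_mem_cosetTets hk hη hSa.subset h𝒟 hT hp hq i)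
    (exists_mem_cosetTets hk hη hSa.subset h𝒟 r) fun T hT => ?_⟩
  obtain ⟨ℓ, hℓ, hT⟩ := hT
  by_cases h : IsAtomistic k Sa η ℓ ∨ IsInterfacial k M Sa η ℓ
  · have hTA := hAK T (interpolable_of_mem_bondTets hk hη hSa.subset h𝒟 hT)
    refine ⟨A T, hTA.1, hTA.2.weaken (le_max_of_le_right (hK₁ ⟨T, ?_, rfl⟩))⟩
    exact mem_iUnion₂.2 ⟨ℓ, (mem_activeBonds_iff hk hη hSa hηR).2 h, hT⟩
  · rw [bondTets_of_not h] at hT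
    obtain ⟨B, hB, hBK⟩ := exists_chainMap_of_mem_cellTets hk hC hT.1
    exact ⟨B, hB, hBK.weaken (le_max_left _ _)⟩

lemma interp_cosetTets_eq_of_notMem (hk : 0 < k) (hη : ∀ i, η i ≠ 0) (hSa : IsSplitting k M R Sa)
    (hηR : η ∈ R) (h𝒟 : IsAdmissible k M Sa η 𝒟) (v : Lat → R3) (r : Lat) {x : R3}
    (hx : x ∉ closure (region k Sa)) :
    interp k (cosetTets k M Sa η 𝒟 r) v x = interp k cellTets v x := by
  obtain ⟨T, hT, hxT⟩ := exists_mem_cosetTets hk hη hSa.subset h𝒟 r x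
  obtain ⟨w, hw⟩ := (mem_tet_iff hk).1 hxT
  rw [(isMesh_cosetTets hk hη hSa hηR h𝒟 r).interp_eq hT hw]
  obtain ⟨ℓ, -, hT⟩ := hT
  have hcell : T ∈ cellTets :=
    (subordinate_of_mem_bondTets hk hη hSa.subset h𝒟 hT).resolve_left fun h => hx (h hxT)
  rw [(isMesh_cellTets hk).interp_eq hcell hw]

lemma interp_cosetTets_eq_of_mem (hk : 0 < k) (hη : ∀ i, η i ≠ 0) (hSa : IsSplitting k M R Sa)
    (hηR : η ∈ R) (h𝒟 : IsAdmissible k M Sa η 𝒟) (v : Lat → R3) {r ℓ : Lat}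
    (hℓ : ∀ i, η i ∣ ℓ i - r i) {x : R3} (hx : x ∈ closure (bondVolume k ℓ η)) :
    interp k (cosetTets k M Sa η 𝒟 r) v x = interp k (bondTets k M Sa η 𝒟 ℓ) v x := by
  obtain ⟨T, hT, hxT⟩ := exists_mem_bondTets hk hη hSa.subset h𝒟 hx
  obtain ⟨w, hw⟩ := (mem_tet_iff hk).1 hxT
  rw [(isMesh_cosetTets hk hη hSa hηR h𝒟 r).interp_eq ⟨ℓ, hℓ, hT⟩ hw,
    (isMesh_bondTets hk hη hSa hηR h𝒟 ℓ).interp_eq hT hw]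

/-! ### Periodic displacements and the balance of mean gradients. -/

variable {v : Lat → R3}

lemma exists_norm_le_of_mem_displacements (hk : 0 < k) (hM : ∀ i, 0 < M i)
    (hv : v ∈ displacements k M) : ∃ C : NNReal, ∀ p, ‖v p‖ ≤ C := by
  let L : Lat := fun i => (k : ℤ) * (2 * (M i : ℤ) - 1)
  have hL : ∀ i, 0 < L i := fun i => by
    have := hM i
    have h2 : (0 : ℤ) < 2 * (M i : ℤ) - 1 := by omega
    positivity
  -- The group of periods of `v`; modulo it, every index is equivalent to one in the finite box `Q`.
  let G : AddSubgroup Lat :=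
    { carrier := {g | ∀ ℓ, v (ℓ + g) = v ℓ}
      zero_mem' := fun ℓ => by rw [add_zero]
      add_mem' := fun {a b} ha hb ℓ => by rw [← add_assoc, hb, ha]
      neg_mem' := fun {a} ha ℓ => by rw [← ha (ℓ + -a), neg_add_cancel_right] }
  have hG : ∀ i, Pi.single i (L i) ∈ G := fun i ℓ => hv.1 ℓ i
  let Q : Finset Lat := Finset.Icc 0 L
  refine ⟨Q.sup fun q => ‖v q‖₊, fun p => ?_⟩
  let q : Lat := fun i => p i % L i
  have hq : q ∈ Q := by
    rw [Finset.mem_Icc]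
    exact ⟨fun i => Int.emod_nonneg _ (hL i).ne', fun i => (Int.emod_lt_of_pos _ (hL i)).le⟩
  have hg : ∑ i, (p i / L i) • (Pi.single i (L i) : Lat) ∈ G :=
    sum_mem fun i _ => G.zsmul_mem (hG i) _
  have hp : p = q + ∑ i, (p i / L i) • (Pi.single i (L i) : Lat) := by
    funext j
    simp only [q, Pi.add_apply, Finset.sum_apply, Pi.smul_apply, smul_eq_mul, Pi.single_apply,
      mul_ite, mul_zero, Finset.sum_ite_eq, Finset.mem_univ, if_true]
    rw [mul_comm, Int.emod_add_mul_ediv]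
  have : ‖v p‖₊ = ‖v q‖₊ := by
    conv_lhs => rw [hp]
    rw [hg q]
  rw [← coe_nnnorm, this, NNReal.coe_le_coe]
  exact Finset.le_sup (f := fun q => ‖v q‖₊) hq

/-- In the integral formula the translation adds the integer `k * (2 * M i - 1)` under the floor,
which is a period of `v`. -/
lemma interp_cellTets_periodic (hk : 0 < k) (hv : v ∈ displacements k M) (x : R3) (i : Fin 3) :
    interp k cellTets v (x + Pi.single i (2 * (M i : ℝ) - 1)) = interp k cellTets v x := by
  rw [interp_cellTets_eq_integral hk, interp_cellTets_eq_integral hk]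
  congr 1
  funext s
  rw [← hv.1 (fun j => ⌊(k : ℝ) * x j + s⌋) i]
  congr 1
  funext j
  rw [Pi.add_apply, Pi.add_apply]
  rcases eq_or_ne j i with rfl | hj
  · rw [Pi.single_eq_same, Pi.single_eq_same, ← Int.floor_add_intCast]
    congr 1
    push_cast
    ring
  · rw [Pi.single_eq_of_ne hj, Pi.single_eq_of_ne hj, add_zero, add_zero]

lemma setIntegral_domain_fderiv (hk : 0 < k) (hM : ∀ i, 0 < M i) (hv : v ∈ displacements k M)
    (h : R3) : ∫ x in domain M, fderiv ℝ (interp k cellTets v) x h = 0 := by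
  obtain ⟨C, hC⟩ := exists_norm_le_of_mem_displacements hk hM hv
  have e : domain M = Icc (fun i => -(M i : ℝ) + 1)
      ((fun i => -(M i : ℝ) + 1) + fun i => 2 * (M i : ℝ) - 1) := by
    rw [domain]
    congr 1
    funext i
    simp only [Pi.add_apply]
    ring
  rw [e]
  refine setIntegral_fderiv_of_periodic _ (fun i => ?_) (lipschitzWith_interp_cellTets hk hC)
    (interp_cellTets_periodic hk hv) _ _
  have : (1 : ℝ) ≤ M i := by exact_mod_cast hM i
  linarith

lemma integrableOn_fderiv_apply {w : R3 → R3} {C : NNReal} (hw : LipschitzWith C w) {D : Set R3}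
    (hD : volume D ≠ ⊤) (h : R3) : IntegrableOn (fun x => fderiv ℝ w x h) D := by
  refine Measure.integrableOn_of_bounded (M := C * ‖h‖) hD
    (measurable_fderiv_apply_const ℝ w h).aestronglyMeasurable
    (Eventually.of_forall fun x => ?_)
  exact ((fderiv ℝ w x).le_opNorm h).trans
    (mul_le_mul_of_nonneg_right (norm_fderiv_le_of_lipschitz ℝ hw) (norm_nonneg _))

lemma volume_ne_top_of_subset_domain {D : Set R3} (hD : D ⊆ domain M) : volume D ≠ ⊤ :=
  measure_ne_top_of_subset hD (isCompact_domain M).measure_lt_top.ne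

/-- The interpolant on one partition into bond volumes differs from the one on the lattice cells
only in the atomistic region. -/
lemma setIntegral_region_add_setIntegral_acb (hk : 0 < k) (hM : ∀ i, 0 < M i)
    (hη : ∀ i, η i ≠ 0) (hSa : IsSplitting k M R Sa) (hηR : η ∈ R)
    (h𝒟 : IsAdmissible k M Sa η 𝒟) (hv : v ∈ displacements k M) (r : Lat) (h : R3) :
    ∫ x in region k Sa, fderiv ℝ (interp k (cosetTets k M Sa η 𝒟 r) v) x h =
      -∫ x in acbRegion k M Sa, fderiv ℝ (interp k cellTets v) x h := by
  obtain ⟨C, hC⟩ := exists_norm_le_of_mem_displacements hk hM hv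
  obtain ⟨K, hw⟩ := exists_lipschitzWith_interp_cosetTets hk hη hSa hηR h𝒟 hC r
  have hV := lipschitzWith_interp_cellTets hk hC
  set w := interp k (cosetTets k M Sa η 𝒟 r) v
  set V := interp k cellTets v
  have hsub : region k Sa ⊆ domain M := region_subset_domain hSa.subset
  have hsub' : acbRegion k M Sa ⊆ domain M := region_subset_domain sdiff_subset
  have hcl : closure (region k Sa) ⊆ domain M := closure_minimal hsub (isCompact_domain M).isClosed
  have hwV : ∀ x ∉ closure (region k Sa), (w - V) x = 0 := fun x hx =>
    sub_eq_zero.2 (interp_cosetTets_eq_of_notMem hk hη hSa hηR h𝒟 v r hx)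
  have hcs : HasCompactSupport (w - V) :=
    HasCompactSupport.intro ((isCompact_domain M).of_isClosed_subset isClosed_closure hcl) hwV
  have hu : LipschitzWith (K + 6 * k * C) (w - V) := hw.sub hV
  have h0 := integral_fderiv_of_hasCompactSupport hu hcs h
  have hfar : ∀ x ∉ closure (region k Sa), fderiv ℝ (w - V) x h = 0 := by
    intro x hx
    have : (w - V) =ᶠ[𝓝 x] fun _ => 0 := by
      filter_upwards [isClosed_closure.isOpen_compl.mem_nhds hx] with z hz using hwV z hz
    rw [this.fderiv_eq]
    simp
  -- Outside the closure of `Ω_a` the gradient of `w - V` vanishes. The boundary of `Ω_a` does not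
  -- contribute: almost every point of `Ω` is in `Ω_a` or `Ω_*`, and `Ω_*` is disjoint from that
  -- closure.
  have h1 : ∫ x in region k Sa, fderiv ℝ (w - V) x h = 0 := by
    rw [setIntegral_eq_integral_of_ae_compl_eq_zero, h0]
    filter_upwards [ae_mem_region_or_acb hk M Sa] with x hx hxa
    refine hfar x fun hxc => ?_
    exact disjoint_left.1 (disjoint_closure_region_acb hk hSa.subset) hxc
      ((hx (hcl hxc)).resolve_left hxa)
  have h2 : ∫ x in region k Sa, fderiv ℝ (w - V) x h =
      ∫ x in region k Sa, (fderiv ℝ w x h - fderiv ℝ V x h) := by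
    refine integral_congr_ae (ae_restrict_of_ae ?_)
    filter_upwards [hw.ae_differentiableAt (μ := volume), hV.ae_differentiableAt (μ := volume)]
      with x hxw hxV
    rw [fderiv_sub hxw hxV]
    rfl
  rw [h2, integral_sub (integrableOn_fderiv_apply hw (volume_ne_top_of_subset_domain hsub) h)
    (integrableOn_fderiv_apply hV (volume_ne_top_of_subset_domain hsub) h)] at h1
  have hunion : (region k Sa ∪ acbRegion k M Sa : Set R3) =ᵐ[volume] domain M := by
    rw [eventuallyEq_set]
    filter_upwards [ae_mem_region_or_acb hk M Sa] with x hx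
    exact ⟨fun hx' => hx'.elim (fun h => hsub h) fun h => hsub' h, hx⟩
  have h3 := setIntegral_domain_fderiv hk hM hv h
  rw [← setIntegral_congr_set hunion, setIntegral_union (disjoint_regions hk hSa.subset)
    (isOpen_region _).measurableSet
    (integrableOn_fderiv_apply hV (volume_ne_top_of_subset_domain hsub) h)
    (integrableOn_fderiv_apply hV (volume_ne_top_of_subset_domain hsub') h)] at h3
  rw [sub_eq_zero.1 h1]
  exact eq_neg_of_add_eq_zero_left h3

/-! ### Tiling by bond volumes and summation over the partitions. -/

lemma disjoint_bondVolume (hk : 0 < k) (hη : ∀ i, η i ≠ 0) {ℓ ℓ' : Lat} (hne : ℓ ≠ ℓ')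
    (hℓ : ∀ i, η i ∣ ℓ' i - ℓ i) : Disjoint (bondVolume k ℓ η) (bondVolume k ℓ' η) := by
  rw [disjoint_left]
  intro x hx hx'
  rw [mem_bondVolume_iff_relCoord hk hη] at hx hx'
  refine hne (funext fun i => ?_)
  obtain ⟨n, hn⟩ := hℓ i
  have hη' : (η i : ℝ) ≠ 0 := by exact_mod_cast hη i
  have e : relCoord k ℓ η x i = relCoord k ℓ' η x i + n := by
    have hnr : ((ℓ' i : ℝ) - ℓ i) = η i * n := by exact_mod_cast hn
    simp only [relCoord]
    field_simp
    linarith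
  have hn1 : n < 1 := by
    have : (n : ℝ) < 1 := by linarith [(hx i).2, (hx' i).1]
    exact_mod_cast this
  have hn2 : -1 < n := by
    have : (-1 : ℝ) < n := by linarith [(hx i).1, (hx' i).2]
    exact_mod_cast this
  obtain rfl : n = 0 := by omega
  rw [mul_zero] at hn
  exact (sub_eq_zero.1 hn).symm

/-- The exceptional points lie on countably many planes, those that carry the faces of the boxes. -/
lemma ae_mem_cosetIndex (hk : 0 < k) (hη : ∀ i, η i ≠ 0) (r : Lat) :
    ∀ᵐ x : R3, x ∈ bondVolume k (cosetIndex k η r x) η := by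
  have hne : ∀ᵐ x : R3, ∀ i, ∀ n : ℤ, x i ≠ (r i + η i * n) / k := by
    simp only [ae_all_iff]
    intro i n
    exact Measure.ae_eval_ne (μ := fun _ : Fin 3 => (volume : Measure ℝ)) i _
  filter_upwards [hne] with x hx
  rw [mem_bondVolume_iff_relCoord hk hη]
  intro i
  rw [relCoord_cosetIndex hη]
  refine ⟨lt_of_le_of_ne (Int.fract_nonneg _) fun h0 => ?_, Int.fract_lt_one _⟩
  have hk' : (k : ℝ) ≠ 0 := by positivity
  have hη' : (η i : ℝ) ≠ 0 := by exact_mod_cast hη i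
  obtain ⟨n, hn⟩ := Int.fract_eq_zero_iff.1 h0.symm
  refine hx i n ?_
  rw [hn, relCoord]
  field_simp
  ring

/-- Representatives of `ℤ³` modulo `η₁ℤ × η₂ℤ × η₃ℤ`. -/
def residues (η : Lat) : Finset Lat := Fintype.piFinset fun i => Finset.Ico 0 |η i|

lemma card_residues (η : Lat) : ((residues η).card : ℝ) = |(η 0 * η 1 * η 2 : ℝ)| := by
  rw [residues, Fintype.card_piFinset, Fin.prod_univ_three]
  simp only [Int.card_Ico, sub_zero, abs_mul, Nat.cast_mul]
  have : ∀ a : ℤ, ((|a|.toNat : ℕ) : ℝ) = |(a : ℝ)| := by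
    intro a
    rw [← Int.cast_natCast, Int.toNat_of_nonneg (abs_nonneg a), Int.cast_abs]
  simp only [this]

lemma emod_mem_residues (hη : ∀ i, η i ≠ 0) (ℓ : Lat) : (fun i => ℓ i % η i) ∈ residues η := by
  rw [residues, Fintype.mem_piFinset]
  exact fun i => Finset.mem_Ico.2 ⟨Int.emod_nonneg _ (hη i), Int.emod_lt_abs _ (hη i)⟩

lemma emod_of_mem_residues {r ℓ : Lat} (hr : r ∈ residues η) (h : ∀ i, η i ∣ ℓ i - r i) :
    (fun i => ℓ i % η i) = r := by
  funext i
  rw [residues, Fintype.mem_piFinset] at hr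
  obtain ⟨h0, h1⟩ := Finset.mem_Ico.1 (hr i)
  rw [Int.emod_eq_emod_iff_emod_sub_eq_zero.2 (Int.emod_eq_zero_of_dvd (h i)), ← Int.emod_abs,
    Int.emod_eq_of_lt h0 h1]

/-- The bond volumes of one partition tile space up to a null set, and those that meet `Ω_a` are all
active. On each open bond volume the glued interpolant is the local one, so the gradients agree. -/
lemma sum_setIntegral_coset (hk : 0 < k) (hM : ∀ i, 0 < M i)
    (hη : ∀ i, η i ≠ 0) (hSa : IsSplitting k M R Sa) (hηR : η ∈ R)
    (h𝒟 : IsAdmissible k M Sa η 𝒟) (hv : v ∈ displacements k M) {r : Lat} (hr : r ∈ residues η)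
    (h : R3) :
    ∑ ℓ ∈ activeBonds k M Sa η with (fun i => ℓ i % η i) = r,
      ∫ x in bondVolume k ℓ η ∩ region k Sa,
        fderiv ℝ (interp k (bondTets k M Sa η 𝒟 ℓ) v) x h =
      ∫ x in region k Sa, fderiv ℝ (interp k (cosetTets k M Sa η 𝒟 r) v) x h := by
  obtain ⟨C, hC⟩ := exists_norm_le_of_mem_displacements hk hM hv
  obtain ⟨K, hw⟩ := exists_lipschitzWith_interp_cosetTets hk hη hSa hηR h𝒟 hC r
  have hsub : region k Sa ⊆ domain M := region_subset_domain hSa.subset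
  have hdvd : ∀ ℓ : Lat, (fun i => ℓ i % η i) = r → ∀ i, η i ∣ ℓ i - r i := fun ℓ hℓ i =>
    hℓ ▸ Int.dvd_self_sub_emod
  set s : Finset Lat := {ℓ ∈ activeBonds k M Sa η | (fun i => ℓ i % η i) = r} with hs
  have hmem : ∀ ℓ, ℓ ∈ s ↔ ℓ ∈ activeBonds k M Sa η ∧ (fun i => ℓ i % η i) = r := fun ℓ => by
    rw [hs, Finset.mem_filter]
  have hmeas : ∀ ℓ ∈ s, MeasurableSet (bondVolume k ℓ η ∩ region k Sa) := fun ℓ _ =>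
    ((isOpen_bondVolume ℓ η).inter (isOpen_region Sa)).measurableSet
  have hloc : ∀ ℓ ∈ s, ∫ x in bondVolume k ℓ η ∩ region k Sa,
      fderiv ℝ (interp k (bondTets k M Sa η 𝒟 ℓ) v) x h = ∫ x in bondVolume k ℓ η ∩ region k Sa,
      fderiv ℝ (interp k (cosetTets k M Sa η 𝒟 r) v) x h := by
    intro ℓ hℓ
    refine setIntegral_congr_fun (hmeas ℓ hℓ) fun x hx => ?_
    have : interp k (cosetTets k M Sa η 𝒟 r) v =ᶠ[𝓝 x] interp k (bondTets k M Sa η 𝒟 ℓ) v := by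
      filter_upwards [(isOpen_bondVolume ℓ η).mem_nhds hx.1] with z hz
      exact interp_cosetTets_eq_of_mem hk hη hSa hηR h𝒟 v (hdvd ℓ ((hmem ℓ).1 hℓ).2)
        (subset_closure hz)
    simp only [this.fderiv_eq]
  rw [Finset.sum_congr rfl hloc, ← integral_biUnion_finset s hmeas]
  · refine setIntegral_congr_set ?_
    rw [eventuallyEq_set]
    filter_upwards [ae_mem_cosetIndex hk hη r] with x hx
    constructor
    · intro hx'
      obtain ⟨ℓ, -, hxℓ⟩ := mem_iUnion₂.1 hx'
      exact hxℓ.2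
    · intro hxa
      refine mem_iUnion₂.2 ⟨cosetIndex k η r x, (hmem _).2 ⟨?_, ?_⟩, hx, hxa⟩
      · exact (mem_activeBonds_iff hk hη hSa hηR).2
          (isAtomistic_or_isInterfacial hk hSa hηR ⟨x, hx, hxa⟩)
      · exact emod_of_mem_residues hr (dvd_cosetIndex_sub r x)
  · intro ℓ hℓ ℓ' hℓ' hne
    refine (disjoint_bondVolume hk hη hne fun i => ?_).mono inter_subset_left inter_subset_left
    have := dvd_sub (hdvd ℓ' ((hmem ℓ').1 hℓ').2 i) (hdvd ℓ ((hmem ℓ).1 hℓ).2 i)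
    rwa [sub_sub_sub_cancel_right] at this
  · exact fun ℓ _ => integrableOn_fderiv_apply hw
      (volume_ne_top_of_subset_domain (inter_subset_right.trans hsub)) h

/-- Each residue class contributes the same integral, and the number of classes is the factor on the
right. -/
lemma sum_setIntegral_activeBonds (hk : 0 < k) (hM : ∀ i, 0 < M i)
    (hη : ∀ i, η i ≠ 0) (hSa : IsSplitting k M R Sa) (hηR : η ∈ R)
    (h𝒟 : IsAdmissible k M Sa η 𝒟) (hv : v ∈ displacements k M) (h : R3) :
    ∑ ℓ ∈ activeBonds k M Sa η, ∫ x in bondVolume k ℓ η ∩ region k Sa,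
        fderiv ℝ (interp k (bondTets k M Sa η 𝒟 ℓ) v) x h =
      -(|(η 0 * η 1 * η 2 : ℝ)| •
        ∫ x in acbRegion k M Sa, fderiv ℝ (interp k cellTets v) x h) := by
  rw [← Finset.sum_fiberwise_of_maps_to (s := activeBonds k M Sa η) (t := residues η)
    (g := fun ℓ i => ℓ i % η i) fun ℓ _ => emod_mem_residues hη ℓ]
  rw [Finset.sum_congr rfl fun r hr => (sum_setIntegral_coset hk hM hη hSa hηR h𝒟 hv hr h).trans
    (setIntegral_region_add_setIntegral_acb hk hM hη hSa hηR h𝒟 hv r h)]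
  rw [Finset.sum_const, ← card_residues, smul_neg, Nat.cast_smul_eq_nsmul]

lemma volume_real_bondVolume (k : ℕ) (ℓ η : Lat) :
    volume.real (bondVolume k ℓ η) = (1 / (k : ℝ)) ^ 3 * |(η 0 * η 1 * η 2 : ℝ)| := by
  rw [Measure.real, bondVolume, Real.volume_pi_Ioo_toReal fun i => min_le_max, Fin.prod_univ_three]
  simp only [max_sub_min_eq_abs, pos, Pi.add_apply, Int.cast_add, ← sub_div, abs_div, abs_mul,
    Nat.abs_cast, add_sub_cancel_left]
  ring

/-- On a tetrahedron of the type A decomposition the derivative in the direction of the main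
diagonal is the difference quotient. -/
lemma fderiv_interp_bondTets_of_isAtomistic (hk : 0 < k) (hη : ∀ i, η i ≠ 0)
    (hSa : IsSplitting k M R Sa) (hηR : η ∈ R) (h𝒟 : IsAdmissible k M Sa η 𝒟) {ℓ : Lat}
    (hℓ : IsAtomistic k Sa η ℓ) {T : Finset Lat} (hT : T ∈ typeA ℓ η) {x : R3}
    (hx : x ∈ interior (tet k T)) :
    fderiv ℝ (interp k (bondTets k M Sa η 𝒟 ℓ) v) x (fun i => (η i : ℝ)) = diffQuot k η v ℓ := by
  have hT' : T ∈ bondTets k M Sa η 𝒟 ℓ := by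
    rw [bondTets_of_isAtomistic hℓ]
    exact hT
  obtain ⟨A, hA⟩ := interpolable_of_mem_typeA hk hη hT v
  rw [((isMesh_bondTets hk hη hSa hηR h𝒟 ℓ).hasFDerivAt hk hT' hA hx).fderiv]
  obtain ⟨σ, rfl⟩ := mem_typeA_iff.1 hT
  have h0 : ℓ ∈ chainSimplex ℓ η σ := by
    simpa only [chainVertex_zero] using
      chainVertex_mem (ℓ := ℓ) (η := η) (σ := σ) (j := 0) (by omega)
  have h3 : ℓ + η ∈ chainSimplex ℓ η σ := by
    simpa only [chainVertex_three] using
      chainVertex_mem (ℓ := ℓ) (η := η) (σ := σ) (j := 3) (by omega)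
  rw [intCast_eq_smul_pos_sub hk ℓ η, map_smul, LinearMap.coe_toContinuousLinearMap',
    diffQuot, ← hA _ h0, ← hA _ h3]
  congr 1
  exact A.linearMap_vsub _ _

lemma setIntegral_of_isAtomistic (hk : 0 < k) (hη : ∀ i, η i ≠ 0)
    (hSa : IsSplitting k M R Sa) (hηR : η ∈ R) (h𝒟 : IsAdmissible k M Sa η 𝒟) {ℓ : Lat}
    (hℓ : IsAtomistic k Sa η ℓ) :
    ∫ x in bondVolume k ℓ η ∩ region k Sa,
        fderiv ℝ (interp k (bondTets k M Sa η 𝒟 ℓ) v) x (fun i => (η i : ℝ)) =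
      ((1 / (k : ℝ)) ^ 3 * |(η 0 * η 1 * η 2 : ℝ)|) • diffQuot k η v ℓ := by
  rw [inter_eq_left.2 (subset_closure.trans hℓ), ← volume_real_bondVolume k ℓ η,
    ← setIntegral_const]
  refine setIntegral_congr_ae (isOpen_bondVolume ℓ η).measurableSet ?_
  filter_upwards [ae_mem_interior_tet k] with x hx hxB
  obtain ⟨T, hT, hxT⟩ := exists_mem_typeA hk hη (subset_closure hxB)
  exact fderiv_interp_bondTets_of_isAtomistic hk hη hSa hηR h𝒟 hℓ hT (hx T hxT)

/-- The first variation of the energy of one interaction vector vanishes. -/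
lemma sum_diffQuot_add_setIntegral_add_sum (hk : 0 < k) (hM : ∀ i, 0 < M i)
    (hη : ∀ i, η i ≠ 0) (hSa : IsSplitting k M R Sa) (hηR : η ∈ R)
    (h𝒟 : IsAdmissible k M Sa η 𝒟) (hv : v ∈ displacements k M) (A I : Finset Lat)
    (hA : ∀ ℓ, ℓ ∈ A ↔ ℓ ∈ latticePeriod k M ∧ IsAtomistic k Sa η ℓ)
    (hI : ∀ ℓ, ℓ ∈ I ↔ ℓ ∈ latticePeriod k M ∧ IsInterfacial k M Sa η ℓ) :
    (1 / (k : ℝ)) ^ 3 • ∑ ℓ ∈ A, diffQuot k η v ℓ +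
      (∫ x in acbRegion k M Sa, fderiv ℝ (interp k cellTets v) x (fun i => (η i : ℝ))) +
      ∑ ℓ ∈ I, (1 / |(η 0 * η 1 * η 2 : ℝ)|) • ∫ x in bondVolume k ℓ η ∩ region k Sa,
        fderiv ℝ (interp k (𝒟 ℓ : Set (Finset Lat)) v) x (fun i => (η i : ℝ)) = 0 := by
  classical
  have hN : |(η 0 * η 1 * η 2 : ℝ)| ≠ 0 := by
    rw [abs_ne_zero]
    exact_mod_cast mul_ne_zero (mul_ne_zero (hη 0) (hη 1)) (hη 2)
  have hact : activeBonds k M Sa η = A ∪ I := by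
    ext ℓ
    rw [activeBonds, Finset.mem_filter, Finset.mem_union, hA, hI, and_or_left]
  have hdisj : Disjoint A I := by
    rw [Finset.disjoint_left]
    intro ℓ hℓ hℓ'
    exact ((hA ℓ).1 hℓ).2.not_isInterfacial hk hSa.subset ((hI ℓ).1 hℓ').2
  have key := sum_setIntegral_activeBonds hk hM hη hSa hηR h𝒟 hv (fun i => (η i : ℝ))
  rw [hact, Finset.sum_union hdisj,
    Finset.sum_congr rfl fun ℓ hℓ =>
      setIntegral_of_isAtomistic hk hη hSa hηR h𝒟 ((hA ℓ).1 hℓ).2,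
    Finset.sum_congr (s₁ := I) rfl fun ℓ hℓ => by
      rw [bondTets_of_isInterfacial hk hSa.subset ((hI ℓ).1 hℓ).2]] at key
  rw [← Finset.smul_sum] at key
  -- Division by `N` turns the volume factor `ε³N` of the atomistic terms into `ε³`, leaves `1/N` on
  -- the interface terms and gives the A-CB integral coefficient one.
  have key' := congrArg (fun z => (1 / |(η 0 * η 1 * η 2 : ℝ)|) • z) key
  simp only [smul_add, smul_neg, smul_smul] at key'
  rw [one_div_mul_cancel hN, one_smul, mul_left_comm, one_div_mul_cancel hN, mul_one] at key'
  rw [← Finset.smul_sum, add_right_comm, key', neg_add_cancel]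

/-! ### Differentiation of the three parts of the energy. -/

/-- The derivatives of an interpolant take finitely many values on a bounded set. -/
lemma IsMesh.exists_finset_fderiv (h𝒯 : IsMesh k 𝒯) (hk : 0 < k) {D : Set R3}
    (hfin : {T | T ∈ 𝒯 ∧ (tet k T ∩ D).Nonempty}.Finite) (hcov : ∀ x ∈ D, ∃ T ∈ 𝒯, x ∈ tet k T)
    (v : Lat → R3) (h : R3) :
    ∃ V : Finset R3, ∀ᵐ x : R3, x ∈ D → fderiv ℝ (interp k 𝒯 v) x h ∈ V := by
  classical
  have hG : ∀ T, ∃ g : R3, T ∈ 𝒯 → ∀ x ∈ interior (tet k T), fderiv ℝ (interp k 𝒯 v) x h = g := by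
    intro T
    by_cases hT : T ∈ 𝒯
    · obtain ⟨A, hA⟩ := h𝒯.interpolable T hT v
      exact ⟨A.linear h, fun _ x hx => by rw [(h𝒯.hasFDerivAt hk hT hA hx).fderiv]; rfl⟩
    · exact ⟨0, fun hT' => (hT hT').elim⟩
  choose g hg using hG
  refine ⟨hfin.toFinset.image g, ?_⟩
  filter_upwards [ae_mem_interior_tet k] with x hx hxD
  obtain ⟨T, hT, hxT⟩ := hcov x hxD
  rw [hg T hT x (hx T hxT)]
  exact Finset.mem_image_of_mem _ (hfin.mem_toFinset.2 ⟨hT, x, hxT, hxD⟩)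

/-- The homogeneous part has gradient `F` on every tetrahedron, so almost everywhere the strain is
`Fh + t g`, where `g` takes finitely many values because `D` meets finitely many tetrahedra. -/
lemma IsMesh.hasDerivAt_setIntegral (h𝒯 : IsMesh k 𝒯) (hk : 0 < k) {D : Set R3}
    (hDm : MeasurableSet D) (hD : volume D ≠ ⊤)
    (hfin : {T | T ∈ 𝒯 ∧ (tet k T ∩ D).Nonempty}.Finite) (hcov : ∀ x ∈ D, ∃ T ∈ 𝒯, x ∈ tet k T)
    (F : Matrix (Fin 3) (Fin 3) ℝ) (v : Lat → R3) {φ : R3 → ℝ} {h : R3} {L : R3 →L[ℝ] ℝ}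
    (hφ : HasFDerivAt φ L (F.mulVec h)) :
    HasDerivAt
      (fun t : ℝ => ∫ x in D, φ (fderiv ℝ (interp k 𝒯 (homogeneous k F + t • v)) x h))
      (L (∫ x in D, fderiv ℝ (interp k 𝒯 v) x h)) 0 := by
  obtain ⟨V, hV⟩ := h𝒯.exists_finset_fderiv hk hfin hcov v h
  have : IsFiniteMeasure (volume.restrict D) := isFiniteMeasure_restrict.2 hD
  have e : ∀ t : ℝ, ∫ x in D, φ (fderiv ℝ (interp k 𝒯 (homogeneous k F + t • v)) x h) =
      ∫ x in D, φ (F.mulVec h + t • fderiv ℝ (interp k 𝒯 v) x h) := by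
    intro t
    refine setIntegral_congr_ae hDm ?_
    filter_upwards [ae_mem_interior_tet k] with x hx hxD
    obtain ⟨T, hT, hxT⟩ := hcov x hxD
    rw [h𝒯.hasFDerivAt_homogeneous_add hk F v hT (hx T hxT)]
  simp_rw [e]
  exact hasDerivAt_integral_of_ae_mem_finset (measurable_fderiv_apply_const ℝ _ h)
    ((ae_restrict_iff' hDm).2 hV) hφ

lemma diffQuot_homogeneous_add (hk : 0 < k) (F : Matrix (Fin 3) (Fin 3) ℝ) (v : Lat → R3) (t : ℝ)
    (ℓ : Lat) : diffQuot k η (homogeneous k F + t • v) ℓ =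
      F.mulVec (fun i => (η i : ℝ)) + t • diffQuot k η v ℓ := by
  rw [intCast_eq_smul_pos_sub hk ℓ η, Matrix.mulVec_smul, Matrix.mulVec_sub]
  simp only [diffQuot, homogeneous, Pi.add_apply, Pi.smul_apply]
  rw [smul_comm t, ← smul_add]
  congr 1
  rw [smul_sub]
  abel

lemma hasDerivAt_energyAtomistic (hk : 0 < k) (F : Matrix (Fin 3) (Fin 3) ℝ) (v : Lat → R3)
    {φ : Lat → R3 → ℝ} {L : R3 →L[ℝ] ℝ} (hφ : HasFDerivAt (φ η) L (F.mulVec fun i => (η i : ℝ)))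
    (A : Finset Lat) (hA : ∀ ℓ, ℓ ∈ A ↔ ℓ ∈ latticePeriod k M ∧ IsAtomistic k Sa η ℓ) :
    HasDerivAt (fun t : ℝ => energyAtomistic k M Sa φ η (homogeneous k F + t • v))
      (L ((1 / (k : ℝ)) ^ 3 • ∑ ℓ ∈ A, diffQuot k η v ℓ)) 0 := by
  classical
  have e : ∀ t : ℝ, energyAtomistic k M Sa φ η (homogeneous k F + t • v) =
      (1 / (k : ℝ)) ^ 3 *
        ∑ ℓ ∈ A, φ η (F.mulVec (fun i => (η i : ℝ)) + t • diffQuot k η v ℓ) := by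
    intro t
    rw [energyAtomistic]
    congr 1
    refine Finset.sum_congr (by ext ℓ; rw [hA, Finset.mem_filter]) fun ℓ _ => ?_
    rw [diffQuot_homogeneous_add hk]
  simp_rw [e, map_smul, map_sum, smul_eq_mul]
  refine HasDerivAt.const_mul _ (HasDerivAt.fun_sum fun ℓ _ => ?_)
  have h1 : HasDerivAt (fun t : ℝ => F.mulVec (fun i => (η i : ℝ)) + t • diffQuot k η v ℓ)
      (diffQuot k η v ℓ) 0 := by
    simpa using ((hasDerivAt_id (0 : ℝ)).smul_const (diffQuot k η v ℓ)).const_add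
      (F.mulVec fun i => (η i : ℝ))
  have h2 : HasFDerivAt (φ η) L (F.mulVec (fun i => (η i : ℝ)) + (0 : ℝ) • diffQuot k η v ℓ) := by
    simpa using hφ
  exact h2.comp_hasDerivAt 0 h1

lemma hasDerivAt_energyACB (hk : 0 < k) (F : Matrix (Fin 3) (Fin 3) ℝ) (v : Lat → R3)
    {φ : Lat → R3 → ℝ} {L : R3 →L[ℝ] ℝ} (hφ : HasFDerivAt (φ η) L (F.mulVec fun i => (η i : ℝ))) :
    HasDerivAt (fun t : ℝ => energyACB k M Sa φ η (homogeneous k F + t • v))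
      (L (∫ x in acbRegion k M Sa, fderiv ℝ (interp k cellTets v) x (fun i => (η i : ℝ)))) 0 := by
  have hsub : acbRegion k M Sa ⊆ domain M := region_subset_domain sdiff_subset
  exact (isMesh_cellTets hk).hasDerivAt_setIntegral hk (isOpen_region _).measurableSet
    (volume_ne_top_of_subset_domain hsub)
    ((finite_cellTets_inter hk (isCompact_domain M)).subset fun T hT =>
      ⟨hT.1, hT.2.mono (inter_subset_inter_right _ hsub)⟩)
    (fun x _ => exists_mem_cellTets hk x) F v hφ

lemma hasDerivAt_energyInterface (hk : 0 < k) (hη : ∀ i, η i ≠ 0) (hSa : IsSplitting k M R Sa)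
    (hηR : η ∈ R) (h𝒟 : IsAdmissible k M Sa η 𝒟) (F : Matrix (Fin 3) (Fin 3) ℝ) (v : Lat → R3)
    {φ : Lat → R3 → ℝ} {L : R3 →L[ℝ] ℝ} (hφ : HasFDerivAt (φ η) L (F.mulVec fun i => (η i : ℝ)))
    (I : Finset Lat) (hI : ∀ ℓ, ℓ ∈ I ↔ ℓ ∈ latticePeriod k M ∧ IsInterfacial k M Sa η ℓ) :
    HasDerivAt (fun t : ℝ => energyInterface k M Sa φ η 𝒟 (homogeneous k F + t • v))
      (L (∑ ℓ ∈ I, (1 / |(η 0 * η 1 * η 2 : ℝ)|) • ∫ x in bondVolume k ℓ η ∩ region k Sa,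
        fderiv ℝ (interp k (𝒟 ℓ : Set (Finset Lat)) v) x (fun i => (η i : ℝ)))) 0 := by
  classical
  have hsub : region k Sa ⊆ domain M := region_subset_domain hSa.subset
  have e : ∀ t : ℝ, energyInterface k M Sa φ η 𝒟 (homogeneous k F + t • v) =
      ∑ ℓ ∈ I, 1 / |(η 0 * η 1 * η 2 : ℝ)| * ∫ x in bondVolume k ℓ η ∩ region k Sa,
        φ η (fderiv ℝ (interp k (𝒟 ℓ : Set (Finset Lat)) (homogeneous k F + t • v)) x
          (fun i => (η i : ℝ))) := by
    intro t
    rw [energyInterface]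
    refine Finset.sum_congr (by ext ℓ; rw [hI, Finset.mem_filter]) fun ℓ _ => ?_
    rw [setIntegral_indicator (isOpen_region Sa).measurableSet]
  simp_rw [e, map_sum, map_smul, smul_eq_mul]
  refine HasDerivAt.fun_sum fun ℓ hℓ => HasDerivAt.const_mul _ ?_
  have hint := ((hI ℓ).1 hℓ).2
  have hmesh := isMesh_bondTets hk hη hSa hηR h𝒟 ℓ
  rw [bondTets_of_isInterfacial hk hSa.subset hint] at hmesh
  refine hmesh.hasDerivAt_setIntegral hk
    ((isOpen_bondVolume ℓ η).inter (isOpen_region Sa)).measurableSet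
    (volume_ne_top_of_subset_domain (inter_subset_right.trans hsub))
    ((Finset.finite_toSet (𝒟 ℓ)).subset fun T hT => hT.1) (fun x hx => ?_) F v hφ
  have := subset_closure hx.1
  rw [← h𝒟.cover ℓ hint] at this
  simpa using this

end BondVolume

end

theorem proposition4p1 (k : ℕ) (hk : 0 < k) (M : Fin 3 → ℕ) (hM : ∀ i, 0 < M i)
    (R : Finset BondVolume.Lat) (hR : ∀ η ∈ R, η 0 * η 1 * η 2 ≠ 0)
    (F : Matrix (Fin 3) (Fin 3) ℝ) (hF : 0 < F.det)
    (φ : BondVolume.Lat → BondVolume.R3 → ℝ)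
    (hφ : ∀ η ∈ R, DifferentiableAt ℝ (φ η) (F.mulVec (fun i => (η i : ℝ))))
    (Sa : Set (Finset BondVolume.Lat)) (hSa : BondVolume.IsSplitting k M R Sa)
    (𝒯 : BondVolume.Lat → BondVolume.Lat → Finset (Finset BondVolume.Lat))
    (h𝒯 : ∀ η ∈ R, BondVolume.IsAdmissible k M Sa η (𝒯 η))
    (v : BondVolume.Lat → BondVolume.R3) (hv : v ∈ BondVolume.displacements k M) :
    HasDerivAt (fun t : ℝ => BondVolume.energyBV k M R Sa φ 𝒯 (BondVolume.homogeneous k F + t • v))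
      0 0 := by
  classical
  unfold BondVolume.energyBV
  -- This rewrites the base point as well as the derivative; the base point is restored after the
  -- passage to a single `η`.
  rw [show (0 : ℝ) = ∑ η ∈ R, 0 from Finset.sum_const_zero.symm]
  refine HasDerivAt.fun_sum fun η hη => ?_
  rw [Finset.sum_const_zero]
  have hη0 : ∀ i, η i ≠ 0 := by
    intro i hi
    refine hR η hη ?_
    fin_cases i <;> simp_all
  have hφη := (hφ η hη).hasFDerivAt
  let A : Finset BondVolume.Lat :=
    {ℓ ∈ BondVolume.latticePeriod k M | BondVolume.IsAtomistic k Sa η ℓ}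
  let I : Finset BondVolume.Lat :=
    {ℓ ∈ BondVolume.latticePeriod k M | BondVolume.IsInterfacial k M Sa η ℓ}
  have hA : ∀ ℓ, ℓ ∈ A ↔ ℓ ∈ BondVolume.latticePeriod k M ∧ BondVolume.IsAtomistic k Sa η ℓ :=
    fun ℓ => Finset.mem_filter
  have hI : ∀ ℓ, ℓ ∈ I ↔ ℓ ∈ BondVolume.latticePeriod k M ∧ BondVolume.IsInterfacial k M Sa η ℓ :=
    fun ℓ => Finset.mem_filter
  have h := ((BondVolume.hasDerivAt_energyAtomistic hk F v hφη A hA).add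
    (BondVolume.hasDerivAt_energyACB (M := M) (Sa := Sa) hk F v hφη)).add
    (BondVolume.hasDerivAt_energyInterface hk hη0 hSa hη (h𝒯 η hη) F v hφη I hI)
  -- All three derivatives carry the same functional, that of `φ η` at `Fη`, so they combine into
  -- its value at the vector that vanishes.
  rw [← map_add, ← map_add, BondVolume.sum_diffQuot_add_setIntegral_add_sum hk hM hη0 hSa hη
    (h𝒯 η hη) hv A I hA hI, map_zero] at h
  exact h
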